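/- Call $p:(-1,1)\to\mathbb{R}$ a Nehari function if it is positive, even and continuous, $(1-x^2)^2p(x)$ is non-increasing on $[0,1)$, and no nontrivial solution of $u''+pu=0$ on $(-1,1)$ has more than one zero in $(-1,1)$. Let $\mathbb{D}$ be the open unit disk, and let $\phi=(f_1,\dots,f_n):\mathbb{D}\to\mathbb{C}^n$ be holomorphic with $\phi'\neq 0$ everywhere. Put $$\sigma=\tfrac12\log(|f_1'|^2+\cdots+|f_n'|^2),\qquad \mathcal{S}\phi=2(\sigma_{zz}-\sigma_z^2),\qquad K(\phi(z))=-e^{-2\sigma(z)}\Delta\sigma(z),$$ where $\sigma_z=\frac12(\sigma_x-i\sigma_y)$; thus $K$ is the Gaussian curvature of the surface $\phi(\mathbb{D})\subset\mathbb{C}^n=\mathbb{R}^{2n}$. Assume that for some Nehari function $p$ $$|\mathcal{S}\phi(z)|+\tfrac34|\phi'(z)|^2\,|K(\phi(z))|\le 2p(|z|)\qquad\text{for all } z\in\mathbb{D}. \tag{1}$$ Suppose that the boundary curve $\Gamma=\phi(\partial\mathbb{D})\subset\mathbb{C}^n\cup\{\infty\}$ is not simple and let $P\in\mathbb{C}^n\cup\{\infty\}$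 be a cut point of it, that is, there are distinct $\zeta_1,\zeta_2\in\partial\mathbb{D}$ such that $\phi(z)\to P$ in $\mathbb{C}^n\cup\{\infty\}$ (with the topology of the spherical metric) as $z\to\zeta_1$ and as $z\to\zeta_2$, $z\in\mathbb{D}$. Then there is a Euclidean circle or line $C$ through $P$, where lines are understood to contain the point $\infty$, such that $C\setminus\{P\}\subset\phi(\mathbb{D})$. Moreover, equality holds in (1) at every point $z\in\phi^{-1}(C\setminus\{P\})$. -/

import Mathlib

open Set Filter Topology

noncomputable section

namespace HolCurve

/-- A Nehari function: positive, even and continuous on `(-1,1)`, with `(1 - x²)² p(x)`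
non-increasing on `[0,1)`, and such that no nontrivial solution of `u'' + p u = 0` on `(-1,1)`
has more than one zero there. -/
structure IsNehari (p : ℝ → ℝ) : Prop where
  pos : ∀ x ∈ Ioo (-1 : ℝ) 1, 0 < p x
  even : ∀ x ∈ Ioo (-1 : ℝ) 1, p (-x) = p x
  continuousOn : ContinuousOn p (Ioo (-1) 1)
  antitoneOn : AntitoneOn (fun x : ℝ => (1 - x ^ 2) ^ 2 * p x) (Ico 0 1)
  disconjugate : ∀ u v : ℝ → ℝ,
    (∀ x ∈ Ioo (-1 : ℝ) 1, HasDerivAt u (v x) x) →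
    (∀ x ∈ Ioo (-1 : ℝ) 1, HasDerivAt v (-(p x * u x)) x) →
    (∃ x ∈ Ioo (-1 : ℝ) 1, u x ≠ 0) →
    ∀ a ∈ Ioo (-1 : ℝ) 1, ∀ b ∈ Ioo (-1 : ℝ) 1, u a = 0 → u b = 0 → a = b

/-- The Wirtinger derivative `g_z = (1/2) (∂g/∂x - i ∂g/∂y)`. -/
def dz (g : ℂ → ℂ) (z : ℂ) : ℂ :=
  (1 / 2 : ℂ) * (fderiv ℝ g z 1 - Complex.I * fderiv ℝ g z Complex.I)

variable {n : ℕ}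

/-- `σ = (1/2) log (|f₁'|² + ⋯ + |fₙ'|²)` for `φ = (f₁, …, fₙ)`. -/
def sigma (φ : ℂ → EuclideanSpace ℂ (Fin n)) (z : ℂ) : ℝ :=
  (1 / 2 : ℝ) * Real.log (∑ k, ‖deriv φ z k‖ ^ 2)

/-- The Schwarzian derivative `2 (σ_zz - σ_z²)` of a holomorphic curve. -/
def schwarzian (φ : ℂ → EuclideanSpace ℂ (Fin n)) (z : ℂ) : ℂ :=
  2 * (dz (dz fun w => (sigma φ w : ℂ)) z - dz (fun w => (sigma φ w : ℂ)) z ^ 2)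

/-- The Gaussian curvature `-e^{-2σ} Δσ` of the surface traced by `φ`, at the point `φ z`. -/
def gaussCurvature (φ : ℂ → EuclideanSpace ℂ (Fin n)) (z : ℂ) : ℝ :=
  -(Real.exp (-2 * sigma φ z) * Laplacian.laplacian (sigma φ) z)

/-- The quantity `|Sφ(z)| + (3/4) |φ'(z)|² |K(φ(z))|`. -/
def criterionLHS (φ : ℂ → EuclideanSpace ℂ (Fin n)) (z : ℂ) : ℝ :=
  ‖schwarzian φ z‖ + 3 / 4 * ‖deriv φ z‖ ^ 2 * |gaussCurvature φ z|

/-- `P ∈ ℂⁿ ∪ {∞}` is the boundary value of `φ : 𝔻 → ℂⁿ` at the boundary point `ζ`. -/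
def HasBoundaryValue (φ : ℂ → EuclideanSpace ℂ (Fin n)) (ζ : ℂ)
    (P : OnePoint (EuclideanSpace ℂ (Fin n))) : Prop :=
  Tendsto (fun z => (φ z : OnePoint (EuclideanSpace ℂ (Fin n))))
    (𝓝[Metric.ball (0 : ℂ) 1] ζ) (𝓝 P)

/-- `P` is a cut point of the boundary curve of `φ`: it is the boundary value of `φ` at two
distinct points of the unit circle. -/
def IsCutPoint (φ : ℂ → EuclideanSpace ℂ (Fin n))
    (P : OnePoint (EuclideanSpace ℂ (Fin n))) : Prop :=
  ∃ ζ₁ ∈ Metric.sphere (0 : ℂ) 1, ∃ ζ₂ ∈ Metric.sphere (0 : ℂ) 1, ζ₁ ≠ ζ₂ ∧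
    HasBoundaryValue φ ζ₁ P ∧ HasBoundaryValue φ ζ₂ P

/-- A Euclidean circle in `ℂⁿ = ℝ²ⁿ`: centre `c`, radius `r > 0`, in the real plane `c + V`. -/
def IsCircle (S : Set (EuclideanSpace ℂ (Fin n))) : Prop :=
  ∃ (c : EuclideanSpace ℂ (Fin n)) (r : ℝ) (V : Submodule ℝ (EuclideanSpace ℂ (Fin n))),
    0 < r ∧ Module.finrank ℝ V = 2 ∧ S = {x | x - c ∈ V ∧ ‖x - c‖ = r}

/-- A real straight line in `ℂⁿ = ℝ²ⁿ`. -/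
def IsLine (S : Set (EuclideanSpace ℂ (Fin n))) : Prop :=
  ∃ a v : EuclideanSpace ℂ (Fin n), v ≠ 0 ∧ S = {x | ∃ t : ℝ, x = a + t • v}

/-- A Euclidean circle or line, as a subset of `ℂⁿ ∪ {∞}`; lines pass through `∞`. -/
def IsCircleOrLine (C : Set (OnePoint (EuclideanSpace ℂ (Fin n)))) : Prop :=
  (∃ S : Set (EuclideanSpace ℂ (Fin n)), IsCircle S ∧ C = (↑) '' S) ∨
  (∃ S : Set (EuclideanSpace ℂ (Fin n)), IsLine S ∧ C = insert OnePoint.infty ((↑) '' S))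

end HolCurve

end

/-! Everything reduces to curves. The hyperbolic geodesic joining `ζ₁` and `ζ₂` is the image of
`(-1, 1)` under an automorphism `γ` of the disk. Along it, `f = φ ∘ γ` has Ahlfors Schwarzian at
most `|γ'|²` times the left side of (1) at `γ`. Since `γ` has zero Schwarzian, `1 - |γ|² = |γ'| (1 -
x²)` and `|x| ≤ |γ|`, the monotonicity of `(1 - x²)² p` bounds this by `2 p x`
(`ahlforsSchwarzian_geodesic_le`, `IsNehari.criterion_geodesic_le`).

For finite `P`, the function `g = |f - P| |f'|^(-1/2)` satisfies `g'' = (Q - S/2) g`, where `S` is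
the Ahlfors Schwarzian and `Q ≥ 0` is a square (`gauge_equation_identity`). Hence `g'' + p g ≥ 0`.
The inversion of `f` about `P` has speed `g⁻²` and is unbounded at both ends; comparison with a
positive solution of `u'' + p u = 0` then forces `g'' + p g = 0` (`comparison`). So `S = 2 p` and `Q
= 0`. The latter says that the inverted curve has constant direction, so it is a full line, and `f`
runs over a circle punctured at `P`. For `P = ∞` the same argument applies to `f` itself, with `g =
|f'|^(-1/2)`.

The comparison also excludes self-intersections: a return to `f α` would give `u² |f'| = c |f - f
α|²`, which is impossible at `α`. Hence `φ` is injective, so `φ⁻¹(C \ {P})` is exactly the geodesic,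
and `S = 2 p` there turns every inequality in the chain into an equality. -/

noncomputable section

namespace HolCurve

/-! ### Linear differential equations on `(-1, 1)` and a positive solution of `u'' + p u = 0`. -/

section LinearODE

variable {X : Type*} [NormedAddCommGroup X] [NormedSpace ℝ X]

/-- The terms of the Picard series of the linear equation `Y' = A Y`, `Y 0 = y`. -/
def picardTerm (A : ℝ → X →L[ℝ] X) (y : X) : ℕ → ℝ → X
  | 0 => fun _ => y
  | k + 1 => fun x => ∫ t in (0 : ℝ)..x, A t (picardTerm A y k t)

theorem picardTerm_continuousOn_hasDerivAt [CompleteSpace X] {A : ℝ → X →L[ℝ] X}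
    (hA : ContinuousOn A (Ioo (-1) 1)) (y : X) (k : ℕ) :
    ContinuousOn (picardTerm A y k) (Ioo (-1) 1) ∧
    ∀ x ∈ Ioo (-1 : ℝ) 1, HasDerivAt (picardTerm A y (k + 1)) (A x (picardTerm A y k x)) x := by
  have key : ∀ k, ContinuousOn (picardTerm A y k) (Ioo (-1) 1) →
      ∀ x ∈ Ioo (-1 : ℝ) 1, HasDerivAt (picardTerm A y (k + 1)) (A x (picardTerm A y k x)) x := by
    intro k hk x hx
    have hc : ContinuousOn (fun t => A t (picardTerm A y k t)) (Ioo (-1) 1) := hA.clm_apply hk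
    have hnhds : Ioo (-1 : ℝ) 1 ∈ 𝓝 x := Ioo_mem_nhds hx.1 hx.2
    refine intervalIntegral.integral_hasDerivAt_right ?_ ?_ (hc.continuousAt hnhds)
    · refine (hc.mono ?_).intervalIntegrable
      exact (convex_Ioo (-1 : ℝ) 1).ordConnected.uIcc_subset (by norm_num) hx
    · exact hc.stronglyMeasurableAtFilter isOpen_Ioo x hx
  induction k with
  | zero => exact ⟨continuousOn_const, key 0 continuousOn_const⟩
  | succ k ih =>
    have hc : ContinuousOn (picardTerm A y (k + 1)) (Ioo (-1) 1) := fun x hx =>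
      (ih.2 x hx).continuousAt.continuousWithinAt
    exact ⟨hc, key _ hc⟩

/-- The factorial gained from the iterated integration makes the Picard series converge uniformly
wherever `A` is bounded. -/
theorem norm_picardTerm_le {A : ℝ → X →L[ℝ] X} (y : X) {r M : ℝ}
    (hM : ∀ x ∈ Ioo (-r) r, ‖A x‖ ≤ M) (k : ℕ) :
    ∀ x ∈ Ioo (-r) r, ‖picardTerm A y k x‖ ≤ ‖y‖ * (M * |x|) ^ k / k.factorial := by
  induction k with
  | zero => intro x _; simp [picardTerm]
  | succ k ih =>
    intro x hx
    have hr : 0 < r := by linarith [hx.1, hx.2]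
    have hM0 : 0 ≤ M := (norm_nonneg _).trans (hM 0 ⟨by linarith, hr⟩)
    have hsub : ∀ t ∈ Set.uIoc 0 x, t ∈ Ioo (-r) r := fun t ht =>
      (convex_Ioo (-r) r).ordConnected.uIcc_subset ⟨by linarith, hr⟩ hx (uIoc_subset_uIcc ht)
    have hb : ∀ t ∈ Set.uIoc 0 x, ‖A t (picardTerm A y k t)‖ ≤
        ‖y‖ * M ^ (k + 1) / k.factorial * |t| ^ k := by
      intro t ht
      calc ‖A t (picardTerm A y k t)‖ ≤ M * (‖y‖ * (M * |t|) ^ k / k.factorial) :=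
            (A t).le_of_opNorm_le_of_le (hM t (hsub t ht)) (ih t (hsub t ht))
        _ = _ := by rw [mul_pow, pow_succ]; ring
    have hint : |∫ t in (0 : ℝ)..x, ‖y‖ * M ^ (k + 1) / k.factorial * |t| ^ k| =
        ‖y‖ * (M * |x|) ^ (k + 1) / (k + 1).factorial := by
      have e : ∀ s : ℝ, 0 ≤ s → (∫ t in (0 : ℝ)..s, |t| ^ k) = s ^ (k + 1) / (k + 1) := by
        intro s hs
        rw [intervalIntegral.integral_congr (g := fun t => t ^ k)]
        · simp
        · intro t ht
          rw [uIcc_of_le hs] at ht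
          simp [abs_of_nonneg ht.1]
      rw [intervalIntegral.integral_const_mul, abs_mul]
      have e2 : |∫ t in (0 : ℝ)..x, |t| ^ k| = |x| ^ (k + 1) / (k + 1) := by
        rcases le_total 0 x with h | h
        · rw [e x h, abs_of_nonneg h, abs_of_nonneg (by positivity)]
        · have h2 : (∫ t in (0 : ℝ)..x, |t| ^ k) = -∫ t in (0 : ℝ)..(-x), |t| ^ k := by
            have h3 := intervalIntegral.integral_comp_neg (a := 0) (b := x) (fun t : ℝ => |t| ^ k)
            simp only [abs_neg, neg_zero] at h3
            rw [h3, intervalIntegral.integral_symm]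
          rw [h2, e (-x) (by linarith), abs_of_nonpos h, abs_neg, abs_of_nonneg]
          have : 0 ≤ -x := by linarith
          positivity
      rw [e2, abs_of_nonneg (by positivity), Nat.factorial_succ]
      push_cast
      rw [mul_pow]
      field_simp
    calc ‖picardTerm A y (k + 1) x‖ ≤ |∫ t in (0 : ℝ)..x, ‖y‖ * M ^ (k + 1) / k.factorial * |t| ^ k| := by
          refine intervalIntegral.norm_integral_le_abs_of_norm_le ?_ ?_
          · exact (MeasureTheory.ae_restrict_mem measurableSet_uIoc).mono fun t ht => hb t ht
          · exact (by fun_prop : Continuous fun t : ℝ =>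
              ‖y‖ * M ^ (k + 1) / k.factorial * |t| ^ k).intervalIntegrable _ _
      _ = _ := hint

/-- A linear differential equation with continuous coefficients on `(-1, 1)` has global solutions. -/
theorem exists_linearODE_solution [CompleteSpace X] {A : ℝ → X →L[ℝ] X}
    (hA : ContinuousOn A (Ioo (-1) 1)) (y : X) :
    ∃ Y : ℝ → X, Y 0 = y ∧ ∀ x ∈ Ioo (-1 : ℝ) 1, HasDerivAt Y (A x (Y x)) x := by
  have h0 : ∀ k, picardTerm A y (k + 1) 0 = 0 := fun k => by simp [picardTerm]
  refine ⟨fun x => y + ∑' k, picardTerm A y (k + 1) x, by simp [h0], fun x hx => ?_⟩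
  -- `A` may blow up at `±1`, so the series is differentiated termwise on a smaller interval `(-r,
  -- r)` around `x`, where compactness bounds `A`.
  obtain ⟨r, hxr, hr1⟩ : ∃ r, |x| < r ∧ r < 1 := exists_between (abs_lt.2 hx)
  have hxm : x ∈ Ioo (-r) r := abs_lt.1 hxr
  have hr0 : 0 < r := (abs_nonneg x).trans_lt hxr
  have hcpt : ContinuousOn A (Icc (-r) r) := hA.mono (Icc_subset_Ioo (by linarith) hr1)
  obtain ⟨M, hM⟩ := isCompact_Icc.exists_bound_of_continuousOn hcpt
  have hM' : ∀ x ∈ Ioo (-r) r, ‖A x‖ ≤ M := fun x hx => hM x (Ioo_subset_Icc_self hx)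
  have hM0 : 0 ≤ M := (norm_nonneg _).trans (hM' x hxm)
  have hterm : ∀ k, ∀ z ∈ Ioo (-r) r,
      ‖picardTerm A y k z‖ ≤ ‖y‖ * (M ^ k / k.factorial) := by
    intro k z hz
    refine (norm_picardTerm_le y hM' k z hz).trans ?_
    rw [mul_div_assoc]
    have : M * |z| ≤ M := by
      have := abs_lt.2 hz
      nlinarith [abs_nonneg z]
    gcongr
  have hs : Summable fun k : ℕ => ‖y‖ * (M ^ k / k.factorial) :=
    (Real.summable_pow_div_factorial M).mul_left _
  have hd := hasDerivAt_tsum_of_isPreconnected (g := fun k => picardTerm A y (k + 1))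
    (g' := fun k x => A x (picardTerm A y k x)) (y₀ := 0) (y := x) (hs.mul_left M) isOpen_Ioo
    (isPreconnected_Ioo (a := -r) (b := r))
    (fun k z hz => (picardTerm_continuousOn_hasDerivAt hA y k).2 z
      ⟨by linarith [hz.1], by linarith [hz.2]⟩)
    (fun k z hz => (A z).le_of_opNorm_le_of_le (hM' z hz) (hterm k z hz)) ⟨by linarith, hr0⟩
    (by simp [h0]) hxm
  have hsum : Summable fun k => picardTerm A y k x := Summable.of_norm_bounded hs fun k => hterm k x hxm
  have heq : y + ∑' k, picardTerm A y (k + 1) x = ∑' k, picardTerm A y k x := by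
    rw [hsum.tsum_eq_zero_add]; rfl
  rw [← (A x).map_tsum hsum, ← heq] at hd
  exact hd.const_add y

end LinearODE

/-- A Nehari function admits a positive solution of `u'' + p u = 0` on `(-1, 1)`. -/
theorem IsNehari.exists_pos_solution {p : ℝ → ℝ} (hp : IsNehari p) :
    ∃ u v : ℝ → ℝ, (∀ x ∈ Ioo (-1 : ℝ) 1, 0 < u x) ∧
      (∀ x ∈ Ioo (-1 : ℝ) 1, HasDerivAt u (v x) x) ∧
      ∀ x ∈ Ioo (-1 : ℝ) 1, HasDerivAt v (-(p x * u x)) x := by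
  let A : ℝ → (ℝ × ℝ) →L[ℝ] (ℝ × ℝ) := fun x =>
    (ContinuousLinearMap.snd ℝ ℝ ℝ).prod (-(p x • ContinuousLinearMap.fst ℝ ℝ ℝ))
  have hA : ContinuousOn A (Ioo (-1) 1) := by
    have h1 : ContinuousOn (fun x => -(p x • ContinuousLinearMap.fst ℝ ℝ ℝ)) (Ioo (-1) 1) :=
      (hp.continuousOn.smul continuousOn_const).neg
    have : A = fun x => (ContinuousLinearMap.inl ℝ ℝ ℝ).comp (ContinuousLinearMap.snd ℝ ℝ ℝ) +
        (ContinuousLinearMap.inr ℝ ℝ ℝ).comp (-(p x • ContinuousLinearMap.fst ℝ ℝ ℝ)) := by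
      ext x : 3 <;> simp [A]
    rw [this]
    exact continuousOn_const.add (continuousOn_const.clm_comp h1)
  obtain ⟨Y, hY0, hY⟩ := exists_linearODE_solution hA (1, 0)
  have hu : ∀ x ∈ Ioo (-1 : ℝ) 1, HasDerivAt (fun x => (Y x).1) (Y x).2 x := fun x hx =>
    ((ContinuousLinearMap.fst ℝ ℝ ℝ).hasFDerivAt (x := Y x)).comp_hasDerivAt x (hY x hx)
  have hv : ∀ x ∈ Ioo (-1 : ℝ) 1, HasDerivAt (fun x => (Y x).2) (-(p x * (Y x).1)) x := by
    intro x hx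
    have h := ((ContinuousLinearMap.snd ℝ ℝ ℝ).hasFDerivAt (x := Y x)).comp_hasDerivAt x (hY x hx)
    exact h.congr_deriv (by simp [A])
  have hneg : ∀ x ∈ Ioo (-1 : ℝ) 1, -x ∈ Ioo (-1 : ℝ) 1 := fun x hx =>
    ⟨by linarith [hx.2], by linarith [hx.1]⟩
  -- Symmetrizing makes the solution even by construction. A zero at `x` then gives one at `-x`, and
  -- disconjugacy leaves only `x = 0`, where the value is `2`.
  have hu' : ∀ x ∈ Ioo (-1 : ℝ) 1,
      HasDerivAt (fun x => (Y x).1 + (Y (-x)).1) ((Y x).2 - (Y (-x)).2) x := by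
    intro x hx
    have h := (hu (-x) (hneg x hx)).comp x (hasDerivAt_neg x)
    exact ((hu x hx).add h).congr_deriv (by ring)
  have hv' : ∀ x ∈ Ioo (-1 : ℝ) 1, HasDerivAt (fun x => (Y x).2 - (Y (-x)).2)
      (-(p x * ((Y x).1 + (Y (-x)).1))) x := by
    intro x hx
    have h := (hv (-x) (hneg x hx)).comp x (hasDerivAt_neg x)
    exact ((hv x hx).sub h).congr_deriv (by rw [hp.even x hx]; ring)
  refine ⟨_, _, ?_, hu', hv'⟩
  have h00 : (0 : ℝ) ∈ Ioo (-1 : ℝ) 1 := by norm_num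
  have hz : ∀ x ∈ Ioo (-1 : ℝ) 1, (Y x).1 + (Y (-x)).1 ≠ 0 := by
    intro x hx h
    have := hp.disconjugate _ _ hu' hv' ⟨0, h00, by simp [hY0]⟩ x hx (-x) (hneg x hx) h
      (by simpa [add_comm] using h)
    have hx0 : x = 0 := by linarith
    subst hx0
    simp [hY0] at h
  intro x hx
  by_contra! hneg'
  have hcont : ContinuousOn (fun x => (Y x).1 + (Y (-x)).1) (Ioo (-1) 1) := fun x hx =>
    (hu' x hx).continuousAt.continuousWithinAt
  obtain ⟨c, hc, hc0⟩ := isPreconnected_Ioo.intermediate_value hx h00 hcont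
    (show (0 : ℝ) ∈ Icc _ _ from ⟨hneg', by simp [hY0]⟩)
  exact hz c hc hc0

/-! ### Comparison with a positive solution. -/

section Comparison

variable {X : Type*} [NormedAddCommGroup X] [NormedSpace ℝ X]

theorem norm_sub_le_sub_of_norm_deriv_le {I : Set ℝ} (hI : I.OrdConnected) {R R' : ℝ → X}
    {V V' : ℝ → ℝ} (hR : ∀ x ∈ I, HasDerivAt R (R' x) x) (hV : ∀ x ∈ I, HasDerivAt V (V' x) x)
    {a b : ℝ} (ha : a ∈ I) (hb : b ∈ I) (hab : a ≤ b) (h : ∀ x ∈ Icc a b, ‖R' x‖ ≤ V' x) :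
    ‖R b - R a‖ ≤ V b - V a := by
  have hsub : Icc a b ⊆ I := hI.out ha hb
  refine image_norm_le_of_norm_deriv_right_le_deriv_boundary' (f := fun x => R x - R a) (f' := R')
    (B := fun x => V x - V a) (B' := V') (a := a) (b := b) ?_ ?_ ?_ ?_ ?_ ?_ (right_mem_Icc.2 hab)
  · exact fun x hx => ((hR x (hsub hx)).sub_const _).continuousAt.continuousWithinAt
  · exact fun x hx => ((hR x (hsub (Ico_subset_Icc_self hx))).sub_const _).hasDerivWithinAt
  · simp
  · exact fun x hx => ((hV x (hsub hx)).sub_const _).continuousAt.continuousWithinAt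
  · exact fun x hx => ((hV x (hsub (Ico_subset_Icc_self hx))).sub_const _).hasDerivWithinAt
  · exact fun x hx => h x (Ico_subset_Icc_self hx)

/-- If `g'' + p g ≥ 0` with `g > 0` on `(α, β)` and a primitive of a vector field of norm `g⁻²`
is unbounded at both ends, then `g` is a multiple of any positive solution of `u'' + p u = 0`. -/
theorem comparison {α β : ℝ} (hαβ : α < β) {p u v g g₁ g₂ : ℝ → ℝ} {R R' : ℝ → X}
    (hu0 : ∀ x ∈ Ioo α β, 0 < u x)
    (hu : ∀ x ∈ Ioo α β, HasDerivAt u (v x) x)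
    (hv : ∀ x ∈ Ioo α β, HasDerivAt v (-(p x * u x)) x)
    (hg0 : ∀ x ∈ Ioo α β, 0 < g x)
    (hg : ∀ x ∈ Ioo α β, HasDerivAt g (g₁ x) x)
    (hg₁ : ∀ x ∈ Ioo α β, HasDerivAt g₁ (g₂ x) x)
    (hpg : ∀ x ∈ Ioo α β, 0 ≤ g₂ x + p x * g x)
    (hR : ∀ x ∈ Ioo α β, HasDerivAt R (R' x) x)
    (hRn : ∀ x ∈ Ioo α β, ‖R' x‖ ≤ (g x ^ 2)⁻¹)
    (hα : Tendsto (fun x => ‖R x‖) (𝓝[>] α) atTop)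
    (hβ : Tendsto (fun x => ‖R x‖) (𝓝[<] β) atTop) :
    (∀ x ∈ Ioo α β, g₂ x + p x * g x = 0) ∧ ∃ c > 0, ∀ x ∈ Ioo α β, u x = c * g x := by
  -- The Wronskian: `W' = (g'' + p g) u ≥ 0` and `(u / g)' = -W / g²`.
  set W : ℝ → ℝ := fun x => g₁ x * u x - g x * v x with hW
  have hWd : ∀ x ∈ Ioo α β, HasDerivAt W ((g₂ x + p x * g x) * u x) x := fun x hx =>
    (((hg₁ x hx).mul (hu x hx)).sub ((hg x hx).mul (hv x hx))).congr_deriv (by ring)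
  have hVd : ∀ x ∈ Ioo α β, HasDerivAt (fun x => u x / g x) (-(W x * (g x ^ 2)⁻¹)) x := fun x hx =>
    ((hu x hx).div (hg x hx) (hg0 x hx).ne').congr_deriv (by
      have := (hg0 x hx).ne'
      simp only [hW]; field_simp; ring)
  have hVpos : ∀ x ∈ Ioo α β, 0 < u x / g x := fun x hx => div_pos (hu0 x hx) (hg0 x hx)
  have hWmono : MonotoneOn W (Ioo α β) := by
    refine monotoneOn_of_deriv_nonneg (convex_Ioo α β)
      (fun x hx => (hWd x hx).continuousAt.continuousWithinAt)
      (fun x hx => ?_) fun x hx => ?_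
    · rw [interior_Ioo] at hx
      exact (hWd x hx).differentiableAt.differentiableWithinAt
    · rw [interior_Ioo] at hx
      rw [(hWd x hx).deriv]
      exact mul_nonneg (hpg x hx) (hu0 x hx).le
  have hsm : ∀ k : ℝ, ∀ x ∈ Ioo α β, HasDerivAt (fun x => k * (u x / g x))
      (k * -(W x * (g x ^ 2)⁻¹)) x := fun k x hx => (hVd x hx).const_mul k
  have hW0 : ∀ x ∈ Ioo α β, W x = 0 := by
    intro x₀ hx₀
    -- If `W x₀ < 0`, then `W ≤ W x₀` to the left of `x₀`, so `‖R'‖ ≤ g⁻² ≤ (-W x₀)⁻¹ (u / g)'`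
    -- there. Since `u / g > 0`, integration bounds `R` near `α`, a contradiction. If `W x₀ > 0`,
    -- the same argument to the right bounds `R` near `β`.
    rcases lt_trichotomy (W x₀) 0 with hneg | h0 | hpos
    · exfalso
      obtain ⟨x, hx, hxI⟩ := ((hα.eventually_gt_atTop (‖R x₀‖ + (-W x₀)⁻¹ * (u x₀ / g x₀))).and
        (Ioo_mem_nhdsGT hx₀.1)).exists
      have hxI' : x ∈ Ioo α β := ⟨hxI.1, hxI.2.trans hx₀.2⟩
      have hle := norm_sub_le_sub_of_norm_deriv_le ordConnected_Ioo hR (hsm (-W x₀)⁻¹) hxI' hx₀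
        hxI.2.le (fun y hy => by
          have hyI : y ∈ Ioo α β := ⟨hxI.1.trans_le hy.1, hy.2.trans_lt hx₀.2⟩
          refine (hRn y hyI).trans ?_
          have h1 : W y ≤ W x₀ := hWmono hyI hx₀ hy.2
          have h2 : 1 ≤ (-W x₀)⁻¹ * -W y := by
            rw [← div_eq_inv_mul, one_le_div (by linarith)]; linarith
          have h3 : 0 ≤ (g y ^ 2)⁻¹ := by positivity
          nlinarith)
      have h4 : 0 < (-W x₀)⁻¹ * (u x / g x) := mul_pos (by simpa using hneg) (hVpos x hxI')
      have h5 := norm_sub_norm_le (R x) (R x₀)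
      rw [norm_sub_rev] at h5
      linarith
    · exact h0
    · exfalso
      obtain ⟨x, hx, hxI⟩ := ((hβ.eventually_gt_atTop (‖R x₀‖ + (W x₀)⁻¹ * (u x₀ / g x₀))).and
        (Ioo_mem_nhdsLT hx₀.2)).exists
      have hxI' : x ∈ Ioo α β := ⟨hx₀.1.trans hxI.1, hxI.2⟩
      have hle := norm_sub_le_sub_of_norm_deriv_le ordConnected_Ioo hR (hsm (-(W x₀)⁻¹)) hx₀ hxI'
        hxI.1.le (fun y hy => by
          have hyI : y ∈ Ioo α β := ⟨hx₀.1.trans_le hy.1, hy.2.trans_lt hxI.2⟩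
          refine (hRn y hyI).trans ?_
          have h1 : W x₀ ≤ W y := hWmono hx₀ hyI hy.1
          have h2 : 1 ≤ (W x₀)⁻¹ * W y := by
            rw [← div_eq_inv_mul, one_le_div (by linarith)]; linarith
          have h3 : 0 ≤ (g y ^ 2)⁻¹ := by positivity
          nlinarith)
      have h4 : 0 < (W x₀)⁻¹ * (u x / g x) := mul_pos (by simpa using hpos) (hVpos x hxI')
      have h5 := norm_sub_norm_le (R x) (R x₀)
      linarith
  constructor
  · intro x hx
    have h1 : HasDerivAt W 0 x := (hasDerivAt_const x (0 : ℝ)).congr_of_eventuallyEq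
      (eventually_of_mem (Ioo_mem_nhds hx.1 hx.2) hW0)
    have h2 := (hWd x hx).unique h1
    exact (mul_eq_zero.1 h2).resolve_right (hu0 x hx).ne'
  · have hmid : (α + β) / 2 ∈ Ioo α β := ⟨by linarith, by linarith⟩
    refine ⟨u ((α + β) / 2) / g ((α + β) / 2), hVpos _ hmid, fun x hx => ?_⟩
    have hc := isOpen_Ioo.is_const_of_deriv_eq_zero (𝕜 := ℝ) isPreconnected_Ioo
      (f := fun x => u x / g x) (s := Ioo α β)
      (fun y hy => (hVd y hy).differentiableAt.differentiableWithinAt)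
      (fun y hy => by rw [(hVd y hy).deriv, hW0 y hy]; simp) hx hmid
    rw [← hc]
    exact (div_mul_cancel₀ _ (hg0 x hx).ne').symm

end Comparison

/-- The function `D^{1/2} A^{-1/4}`. -/
def gauge (D A : ℝ) : ℝ := Real.exp (1 / 2 * Real.log D - 1 / 4 * Real.log A)

theorem gauge_pos (D A : ℝ) : 0 < gauge D A := Real.exp_pos _

/-- With `D = ‖f - P‖²` and `A = ‖f'‖²` the inverse of this square is `‖f'‖ / ‖f - P‖²`, the speed
of the inverted curve. -/
theorem gauge_sq {D A : ℝ} (hD : 0 < D) (hA : 0 < A) : gauge D A ^ 2 = D / √A := by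
  have h1 : gauge D A ^ 2 = Real.exp (Real.log D - Real.log (√A)) := by
    rw [gauge, ← Real.exp_nat_mul, Real.log_sqrt hA.le]; congr 1; push_cast; ring
  rw [h1, Real.exp_sub, Real.exp_log hD, Real.exp_log (Real.sqrt_pos.2 hA)]

theorem hasDerivAt_gauge {D A : ℝ → ℝ} {D' A' x : ℝ} (hD : HasDerivAt D D' x)
    (hA : HasDerivAt A A' x) (hD0 : D x ≠ 0) (hA0 : A x ≠ 0) :
    HasDerivAt (fun x => gauge (D x) (A x))
      (gauge (D x) (A x) * (D' / (2 * D x) - A' / (4 * A x))) x := by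
  refine (((hD.log hD0).const_mul (1 / 2)).sub ((hA.log hA0).const_mul (1 / 4))).exp.congr_deriv ?_
  simp only [gauge, Pi.sub_apply]
  field_simp

theorem hasDerivAt_gauge_deriv {D D₁ A A₁ : ℝ → ℝ} {D₂ A₂ x : ℝ} (hD : HasDerivAt D (D₁ x) x)
    (hA : HasDerivAt A (A₁ x) x) (hD₁ : HasDerivAt D₁ D₂ x) (hA₁ : HasDerivAt A₁ A₂ x)
    (hD0 : D x ≠ 0) (hA0 : A x ≠ 0) :
    HasDerivAt (fun x => gauge (D x) (A x) * (D₁ x / (2 * D x) - A₁ x / (4 * A x)))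
      (gauge (D x) (A x) * (D₂ / (2 * D x) - D₁ x ^ 2 / (4 * D x ^ 2) - A₂ / (4 * A x)
        + 5 * A₁ x ^ 2 / (16 * A x ^ 2) - D₁ x * A₁ x / (4 * D x * A x))) x := by
  have h1 := hD₁.div (hD.const_mul 2) (mul_ne_zero two_ne_zero hD0)
  have h2 := hA₁.div (hA.const_mul 4) (mul_ne_zero four_ne_zero hA0)
  refine ((hasDerivAt_gauge hD hA hD0 hA0).mul (h1.sub h2)).congr_deriv ?_
  simp only [Pi.sub_apply, Pi.div_apply]
  field_simp
  ring

/-! ### Ahlfors' Schwarzian, inversion, lines and circles. -/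

section Curves

variable {E : Type*} [NormedAddCommGroup E] [InnerProductSpace ℝ E]

/-- Ahlfors' Schwarzian of a curve with the first three derivatives `a`, `b`, `c`. -/
def ahlforsSchwarzian (a b c : E) : ℝ :=
  inner ℝ a c / ‖a‖ ^ 2 - 3 * inner ℝ a b ^ 2 / ‖a‖ ^ 4 + 3 / 2 * ‖b‖ ^ 2 / ‖a‖ ^ 2

/-- The component of `b` orthogonal to `a`. -/
def orthPart (a b : E) : E := b - (inner ℝ a b / ‖a‖ ^ 2) • a

theorem inner_orthPart {a : E} (ha : a ≠ 0) (b : E) : inner ℝ a (orthPart a b) = 0 := by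
  have : ‖a‖ ^ 2 ≠ 0 := by simpa using ha
  rw [orthPart, inner_sub_right, real_inner_smul_right, real_inner_self_eq_norm_sq]
  field_simp; ring

theorem inner_orthPart_orthPart {a : E} (ha : a ≠ 0) (b c : E) :
    inner ℝ (orthPart a b) (orthPart a c) = inner ℝ b c - inner ℝ a b * inner ℝ a c / ‖a‖ ^ 2 := by
  conv_lhs => rw [orthPart]
  rw [inner_sub_left, real_inner_smul_left, inner_orthPart ha, orthPart, inner_sub_right,
    real_inner_smul_right, real_inner_comm a b]
  ring

theorem norm_orthPart_sq {a : E} (ha : a ≠ 0) (b : E) :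
    ‖orthPart a b‖ ^ 2 = ‖b‖ ^ 2 - inner ℝ a b ^ 2 / ‖a‖ ^ 2 := by
  rw [← real_inner_self_eq_norm_sq, inner_orthPart_orthPart ha, real_inner_self_eq_norm_sq, pow_two (inner ℝ a b)]

theorem hasDerivAt_norm_sq {f : ℝ → E} {f' : E} {x : ℝ} (hf : HasDerivAt f f' x) :
    HasDerivAt (fun x => ‖f x‖ ^ 2) (2 * inner ℝ (f x) f') x := by
  have h := hf.inner ℝ hf
  simp only [real_inner_self_eq_norm_sq] at h
  exact h.congr_deriv (by rw [real_inner_comm]; ring)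

/-- The equation satisfied by `|f - P| |f'|^{-1/2}`. -/
theorem gauge_equation_identity {a d : E} (ha : a ≠ 0) (hd : d ≠ 0) (b c : E) :
    2 * (‖a‖ ^ 2 + inner ℝ d b) / (2 * ‖d‖ ^ 2) - (2 * inner ℝ d a) ^ 2 / (4 * (‖d‖ ^ 2) ^ 2)
      - 2 * (‖b‖ ^ 2 + inner ℝ a c) / (4 * ‖a‖ ^ 2)
      + 5 * (2 * inner ℝ a b) ^ 2 / (16 * (‖a‖ ^ 2) ^ 2)
      - 2 * inner ℝ d a * (2 * inner ℝ a b) / (4 * ‖d‖ ^ 2 * ‖a‖ ^ 2) =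
    ‖(‖a‖ / ‖d‖ ^ 2) • orthPart a d + (2 * ‖a‖)⁻¹ • orthPart a b‖ ^ 2
      - 1 / 2 * ahlforsSchwarzian a b c := by
  have ha' : ‖a‖ ≠ 0 := norm_ne_zero_iff.2 ha
  have hd' : ‖d‖ ≠ 0 := norm_ne_zero_iff.2 hd
  rw [norm_add_sq_real, norm_smul, norm_smul, mul_pow ‖_ / _‖, mul_pow ‖_⁻¹‖, norm_orthPart_sq ha,
    norm_orthPart_sq ha, real_inner_smul_left, real_inner_smul_right, inner_orthPart_orthPart ha,
    ahlforsSchwarzian, real_inner_comm a d, Real.norm_eq_abs, Real.norm_eq_abs, sq_abs, sq_abs]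
  field_simp
  ring

/-- The equation satisfied by `|f'|^{-1/2}`. -/
theorem gauge_equation_identity_infty {a : E} (ha : a ≠ 0) (b c : E) :
    - (2 * (‖b‖ ^ 2 + inner ℝ a c) / (4 * ‖a‖ ^ 2))
      + 5 * (2 * inner ℝ a b) ^ 2 / (16 * (‖a‖ ^ 2) ^ 2) =
    ‖(2 * ‖a‖)⁻¹ • orthPart a b‖ ^ 2 - 1 / 2 * ahlforsSchwarzian a b c := by
  have ha' : ‖a‖ ≠ 0 := norm_ne_zero_iff.2 ha
  rw [norm_smul, mul_pow ‖_⁻¹‖, norm_orthPart_sq ha, ahlforsSchwarzian, Real.norm_eq_abs, sq_abs]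
  field_simp
  ring

/-- The vector `‖d‖⁻² d`, image of `d` under the inversion in the unit sphere. -/
def invert (d : E) : E := (‖d‖ ^ 2)⁻¹ • d

theorem norm_invert {d : E} (hd : d ≠ 0) : ‖invert d‖ = ‖d‖⁻¹ := by
  have hd' : ‖d‖ ≠ 0 := norm_ne_zero_iff.2 hd
  rw [invert, norm_smul, norm_inv, norm_pow, norm_norm]
  field_simp

theorem invert_invert {d : E} (hd : d ≠ 0) : invert (invert d) = d := by
  have hd' : ‖d‖ ≠ 0 := norm_ne_zero_iff.2 hd
  have h : ‖invert d‖ ^ 2 = (‖d‖ ^ 2)⁻¹ := by rw [norm_invert hd, inv_pow]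
  rw [invert, h, invert, smul_smul, inv_inv, mul_inv_cancel₀ (by positivity), one_smul]

theorem invert_ne_zero {d : E} (hd : d ≠ 0) : invert d ≠ 0 := by
  rw [← norm_ne_zero_iff, norm_invert hd]
  exact inv_ne_zero (norm_ne_zero_iff.2 hd)

/-- The vector `a`, reflected in the hyperplane orthogonal to `d`. -/
def reflectAlong (d a : E) : E := a - (2 * inner ℝ d a / ‖d‖ ^ 2) • d

theorem norm_reflectAlong {d : E} (hd : d ≠ 0) (a : E) : ‖reflectAlong d a‖ = ‖a‖ := by
  have hd' : ‖d‖ ≠ 0 := norm_ne_zero_iff.2 hd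
  have h : ‖reflectAlong d a‖ ^ 2 = ‖a‖ ^ 2 := by
    rw [reflectAlong, norm_sub_sq_real, norm_smul, mul_pow, real_inner_smul_right,
      real_inner_comm, Real.norm_eq_abs, sq_abs]
    field_simp
    ring
  exact (pow_left_inj₀ (norm_nonneg _) (norm_nonneg _) two_ne_zero).1 h

/-- Inversion is conformal: its differential at `d` is `‖d‖⁻²` times a reflection, so speeds are
divided by `‖d‖²`. -/
theorem hasDerivAt_invert {f : ℝ → E} {f' : E} {x : ℝ} (hf : HasDerivAt f f' x) (h0 : f x ≠ 0) :
    HasDerivAt (fun x => invert (f x)) ((‖f x‖ ^ 2)⁻¹ • reflectAlong (f x) f') x := by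
  have hd' : ‖f x‖ ^ 2 ≠ 0 := by simpa using h0
  refine (((hasDerivAt_norm_sq hf).inv hd').smul hf).congr_deriv ?_
  simp only [reflectAlong, smul_sub, smul_smul, Pi.inv_apply]
  rw [sub_eq_add_neg, ← neg_smul]
  congr 2
  field_simp

/-- A regular curve of constant direction that is unbounded at both ends runs over a line. -/
theorem image_eq_line {α β : ℝ} (hαβ : α < β) {R : ℝ → E} {ρ : ℝ → ℝ} {e : E} (he : ‖e‖ = 1)
    (hρ : ∀ x ∈ Ioo α β, 0 < ρ x)
    (hR : ∀ x ∈ Ioo α β, HasDerivAt R (ρ x • e) x)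
    (hα : Tendsto (fun x => ‖R x‖) (𝓝[>] α) atTop)
    (hβ : Tendsto (fun x => ‖R x‖) (𝓝[<] β) atTop) :
    ∃ q : E, inner ℝ q e = 0 ∧ R '' Ioo α β = {y | ∃ s : ℝ, y = q + s • e} := by
  set l : ℝ → ℝ := fun x => inner ℝ (R x) e with hl
  have hee : inner ℝ e e = (1 : ℝ) := by rw [real_inner_self_eq_norm_sq, he]; norm_num
  have hld : ∀ x ∈ Ioo α β, HasDerivAt l (ρ x) x := fun x hx =>
    ((hR x hx).inner ℝ (hasDerivAt_const x e)).congr_deriv (by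
      rw [real_inner_smul_left, hee]; simp)
  have hlc : ContinuousOn l (Ioo α β) := fun x hx => (hld x hx).continuousAt.continuousWithinAt
  have hmid : (α + β) / 2 ∈ Ioo α β := ⟨by linarith, by linarith⟩
  set x₀ := (α + β) / 2
  -- The component of `R` orthogonal to `e` does not move; it is the foot `q` of the line.
  have hconst : ∀ x ∈ Ioo α β, R x - l x • e = R x₀ - l x₀ • e := by
    intro x hx
    have hd : ∀ y ∈ Ioo α β, HasDerivAt (fun x => R x - l x • e) 0 y := fun y hy =>
      ((hR y hy).sub ((hld y hy).smul_const e)).congr_deriv (by simp)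
    exact isOpen_Ioo.is_const_of_deriv_eq_zero (𝕜 := ℝ) isPreconnected_Ioo
      (fun y hy => (hd y hy).differentiableAt.differentiableWithinAt)
      (fun y hy => (hd y hy).deriv) hx hmid
  set q := R x₀ - l x₀ • e with hq
  have hRq : ∀ x ∈ Ioo α β, R x = q + l x • e := fun x hx => by rw [← hconst x hx]; simp
  have hmono : MonotoneOn l (Ioo α β) := by
    refine monotoneOn_of_deriv_nonneg (convex_Ioo α β) hlc
      (fun x hx => ?_) fun x hx => ?_
    · rw [interior_Ioo] at hx
      exact (hld x hx).differentiableAt.differentiableWithinAt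
    · rw [interior_Ioo] at hx
      rw [(hld x hx).deriv]
      exact (hρ x hx).le
  have hnorm : ∀ x ∈ Ioo α β, ‖R x‖ ≤ ‖q‖ + |l x| := fun x hx => by
    rw [hRq x hx]
    refine (norm_add_le _ _).trans ?_
    rw [norm_smul, he, mul_one, Real.norm_eq_abs]
  refine ⟨q, ?_, Subset.antisymm ?_ ?_⟩
  · rw [hq, inner_sub_left, real_inner_smul_left, hee]; simp [hl]
  · rintro _ ⟨x, hx, rfl⟩
    exact ⟨l x, hRq x hx⟩
  · rintro _ ⟨s, rfl⟩
    -- Near `α` the norm of `R` exceeds `‖q‖ + |l x₀| + |s|`, so `|l x| > |l x₀| + |s|`. As `l x ≤ l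
    -- x₀`, the value `l x` must be negative and below `s`.
    have hlow : ∃ x ∈ Ioo α β, l x ≤ s := by
      obtain ⟨x, hx, hxI⟩ := ((hα.eventually_gt_atTop (‖q‖ + |l x₀| + |s|)).and
        (Ioo_mem_nhdsGT hmid.1)).exists
      have hxI' : x ∈ Ioo α β := ⟨hxI.1, hxI.2.trans hmid.2⟩
      refine ⟨x, hxI', ?_⟩
      have h1 := hmono hxI' hmid hxI.2.le
      have h2 := hnorm x hxI'
      rcases abs_cases (l x) with h | h <;> linarith [le_abs_self (l x₀), neg_abs_le s, abs_nonneg s, abs_nonneg (l x₀)]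
    have hhigh : ∃ x ∈ Ioo α β, s ≤ l x := by
      obtain ⟨x, hx, hxI⟩ := ((hβ.eventually_gt_atTop (‖q‖ + |l x₀| + |s|)).and
        (Ioo_mem_nhdsLT hmid.2)).exists
      have hxI' : x ∈ Ioo α β := ⟨hmid.1.trans hxI.1, hxI.2⟩
      refine ⟨x, hxI', ?_⟩
      have h1 := hmono hmid hxI' hxI.1.le
      have h2 := hnorm x hxI'
      rcases abs_cases (l x) with h | h <;> linarith [neg_abs_le (l x₀), le_abs_self s, abs_nonneg s, abs_nonneg (l x₀)]
    obtain ⟨x, hx, hxs⟩ := hlow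
    obtain ⟨y, hy, hys⟩ := hhigh
    obtain ⟨z, hz, hzs⟩ := isPreconnected_Ioo.intermediate_value hx hy hlc
      (show s ∈ Icc _ _ from ⟨hxs, hys⟩)
    exact ⟨z, hz, by rw [hRq z hz, hzs]⟩

/-- The inversion of a line that misses the origin is a circle through the origin, punctured
there. -/
theorem invert_image_line (P : E) {q e : E} (he : ‖e‖ = 1) (hq : q ≠ 0) (hqe : inner ℝ q e = 0) :
    ∃ (c : E) (r : ℝ) (V : Submodule ℝ E), 0 < r ∧ Module.finrank ℝ V = 2 ∧
      P ∈ {x | x - c ∈ V ∧ ‖x - c‖ = r} ∧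
      (fun y => P + invert y) '' {y | ∃ s : ℝ, y = q + s • e} =
        {x | x - c ∈ V ∧ ‖x - c‖ = r} \ {P} := by
  have hq' : ‖q‖ ≠ 0 := norm_ne_zero_iff.2 hq
  have hqpos : 0 < ‖q‖ := norm_pos_iff.2 hq
  have he0 : e ≠ 0 := by rw [← norm_ne_zero_iff, he]; exact one_ne_zero
  have hee : inner ℝ e e = (1 : ℝ) := by rw [real_inner_self_eq_norm_sq, he]; norm_num
  have hqq : inner ℝ q q = ‖q‖ ^ 2 := real_inner_self_eq_norm_sq q
  have heq : inner ℝ e q = (0 : ℝ) := by rw [real_inner_comm]; exact hqe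
  have hli : LinearIndependent ℝ ![q, e] := by
    rw [LinearIndependent.pair_iff]
    intro s t hst
    have h1 := congrArg (inner ℝ q) hst
    have h2 := congrArg (inner ℝ e) hst
    simp only [inner_add_right, real_inner_smul_right, hqq, hqe, heq, hee, inner_zero_right] at h1 h2
    constructor
    · simpa [hq'] using h1
    · simpa using h2
  set V : Submodule ℝ E := Submodule.span ℝ (Set.range ![q, e]) with hV
  have hVmem : ∀ y, y ∈ V ↔ ∃ s t : ℝ, s • q + t • e = y := by
    intro y
    rw [hV, Matrix.range_cons, Matrix.range_cons, Matrix.range_empty, Set.union_empty,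
      Set.singleton_union, Submodule.mem_span_pair]
  have hqV : q ∈ V := (hVmem q).2 ⟨1, 0, by simp⟩
  have heV : e ∈ V := (hVmem e).2 ⟨0, 1, by simp⟩
  -- The circle has the segment from `P` to `P + invert q` as a diameter. For `d ≠ 0` its equation
  -- becomes `⟨invert d, q⟩ = ‖q‖²`, which within `V` describes the line `q + ℝ e`.
  have hnorm : ∀ d : E, ‖d - (2 * ‖q‖ ^ 2)⁻¹ • q‖ = (2 * ‖q‖)⁻¹ ↔ ‖d‖ ^ 2 * ‖q‖ ^ 2 = inner ℝ d q := by
    intro d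
    rw [← pow_left_inj₀ (norm_nonneg _) (by positivity) two_ne_zero, norm_sub_sq_real, norm_smul,
      mul_pow, real_inner_smul_right, Real.norm_eq_abs, sq_abs]
    constructor
    · intro h
      field_simp at h
      linarith
    · intro h
      field_simp
      linarith
  refine ⟨P + (2 * ‖q‖ ^ 2)⁻¹ • q, (2 * ‖q‖)⁻¹, V, by positivity, ?_, ?_, ?_⟩
  · rw [hV, finrank_span_eq_card hli]; simp
  · constructor
    · have : P - (P + (2 * ‖q‖ ^ 2)⁻¹ • q) = (-(2 * ‖q‖ ^ 2)⁻¹) • q := by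
        rw [neg_smul]; abel
      rw [this]
      exact V.smul_mem _ hqV
    · have := (hnorm 0).2 (by simp)
      rw [← sub_sub, sub_self]
      exact this
  · have hsub : ∀ d : E, P + d - (P + (2 * ‖q‖ ^ 2)⁻¹ • q) = d - (2 * ‖q‖ ^ 2)⁻¹ • q := fun d => by
      abel
    ext x
    constructor
    · rintro ⟨_, ⟨s, rfl⟩, rfl⟩
      have hin : inner ℝ (q + s • e) q = ‖q‖ ^ 2 := by
        rw [inner_add_left, real_inner_smul_left, heq, hqq]; ring
      have hne : q + s • e ≠ 0 := by
        intro h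
        rw [h, inner_zero_left] at hin
        exact hq' (by simpa using hin.symm)
      have hne' : ‖q + s • e‖ ≠ 0 := norm_ne_zero_iff.2 hne
      refine ⟨⟨?_, ?_⟩, ?_⟩
      · simp only [hsub]
        refine V.sub_mem (V.smul_mem _ (V.add_mem hqV (V.smul_mem _ heV))) (V.smul_mem _ hqV)
      · simp only [hsub]
        rw [hnorm, norm_invert hne, invert, real_inner_smul_left, hin]
        simp
      · simpa using invert_ne_zero hne
    · rintro ⟨⟨hx1, hx2⟩, hxP⟩
      obtain ⟨d, rfl⟩ : ∃ d, x = P + d := ⟨x - P, by abel⟩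
      have hd : d ≠ 0 := by rintro rfl; exact hxP (by simp)
      have hd' : ‖d‖ ≠ 0 := norm_ne_zero_iff.2 hd
      rw [hsub, hnorm] at hx2
      rw [hsub] at hx1
      have hdV : d ∈ V := by
        have := V.add_mem hx1 (V.smul_mem (2 * ‖q‖ ^ 2)⁻¹ hqV)
        simpa using this
      refine ⟨invert d, ?_, by simp only [invert_invert hd]⟩
      obtain ⟨s, t, hst⟩ := (hVmem _).1 (V.smul_mem (‖d‖ ^ 2)⁻¹ hdV)
      have hs : s = 1 := by
        have h1 : inner ℝ (invert d) q = ‖q‖ ^ 2 := by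
          rw [invert, real_inner_smul_left, ← hx2]; field_simp
        rw [invert, ← hst, inner_add_left, real_inner_smul_left, real_inner_smul_left, heq, hqq] at h1
        have : (s - 1) * ‖q‖ ^ 2 = 0 := by linarith
        rcases mul_eq_zero.1 this with h | h
        · linarith
        · exact absurd h (by positivity)
      refine ⟨t, ?_⟩
      rw [invert, ← hst, hs, one_smul]

end Curves

/-! ### Rigidity of curves under the Schwarzian bound. -/

section Curves

variable {E : Type*} [NormedAddCommGroup E] [InnerProductSpace ℝ E]

/-- A regular curve on `(α, β)` with its first three derivatives. -/
structure IsRegularCurve (α β : ℝ) (f f₁ f₂ f₃ : ℝ → E) : Prop where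
  deriv₁ : ∀ x ∈ Ioo α β, HasDerivAt f (f₁ x) x
  deriv₂ : ∀ x ∈ Ioo α β, HasDerivAt f₁ (f₂ x) x
  deriv₃ : ∀ x ∈ Ioo α β, HasDerivAt f₂ (f₃ x) x
  ne_zero : ∀ x ∈ Ioo α β, f₁ x ≠ 0

/-- A positive solution of `u'' + p u = 0` on `(α, β)`. -/
structure IsPosSolution (α β : ℝ) (p u v : ℝ → ℝ) : Prop where
  pos : ∀ x ∈ Ioo α β, 0 < u x
  deriv₁ : ∀ x ∈ Ioo α β, HasDerivAt u (v x) x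
  deriv₂ : ∀ x ∈ Ioo α β, HasDerivAt v (-(p x * u x)) x

variable {α β : ℝ} {f f₁ f₂ f₃ : ℝ → E} {p u v : ℝ → ℝ}

theorem IsRegularCurve.mono {α' β' : ℝ} (h : IsRegularCurve α β f f₁ f₂ f₃) (hα : α ≤ α')
    (hβ : β' ≤ β) : IsRegularCurve α' β' f f₁ f₂ f₃ :=
  have hs : Ioo α' β' ⊆ Ioo α β := Ioo_subset_Ioo hα hβ
  ⟨fun x hx => h.deriv₁ x (hs hx), fun x hx => h.deriv₂ x (hs hx), fun x hx => h.deriv₃ x (hs hx),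
    fun x hx => h.ne_zero x (hs hx)⟩

theorem IsPosSolution.mono {α' β' : ℝ} (h : IsPosSolution α β p u v) (hα : α ≤ α')
    (hβ : β' ≤ β) : IsPosSolution α' β' p u v :=
  have hs : Ioo α' β' ⊆ Ioo α β := Ioo_subset_Ioo hα hβ
  ⟨fun x hx => h.pos x (hs hx), fun x hx => h.deriv₁ x (hs hx), fun x hx => h.deriv₂ x (hs hx)⟩

theorem IsRegularCurve.hasDerivAt_norm_sq_deriv (h : IsRegularCurve α β f f₁ f₂ f₃) {x : ℝ}
    (hx : x ∈ Ioo α β) : HasDerivAt (fun x => 2 * inner ℝ (f₁ x) (f₂ x))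
      (2 * (‖f₂ x‖ ^ 2 + inner ℝ (f₁ x) (f₃ x))) x :=
  (((h.deriv₂ x hx).inner ℝ (h.deriv₃ x hx)).const_mul 2).congr_deriv (by
    rw [real_inner_self_eq_norm_sq]; ring)

/-- Rigidity for a curve both of whose ends converge to the same finite point. -/
theorem IsRegularCurve.rigid (h : IsRegularCurve α β f f₁ f₂ f₃) (hαβ : α < β)
    (hu : IsPosSolution α β p u v) {P : E} (hP : ∀ x ∈ Ioo α β, f x ≠ P)
    (hS : ∀ x ∈ Ioo α β, ahlforsSchwarzian (f₁ x) (f₂ x) (f₃ x) ≤ 2 * p x)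
    (hα : Tendsto f (𝓝[>] α) (𝓝 P)) (hβ : Tendsto f (𝓝[<] β) (𝓝 P)) :
    (∀ x ∈ Ioo α β, ahlforsSchwarzian (f₁ x) (f₂ x) (f₃ x) = 2 * p x) ∧
    (∀ x ∈ Ioo α β, (‖f₁ x‖ / ‖f x - P‖ ^ 2) • orthPart (f₁ x) (f x - P) +
      (2 * ‖f₁ x‖)⁻¹ • orthPart (f₁ x) (f₂ x) = 0) ∧
    ∃ c > 0, ∀ x ∈ Ioo α β, u x ^ 2 * ‖f₁ x‖ = c * ‖f x - P‖ ^ 2 := by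
  have hd : ∀ x ∈ Ioo α β, f x - P ≠ 0 := fun x hx => sub_ne_zero.2 (hP x hx)
  have hdd : ∀ x ∈ Ioo α β, HasDerivAt (fun x => f x - P) (f₁ x) x := fun x hx =>
    (h.deriv₁ x hx).sub_const P
  have hDpos : ∀ x ∈ Ioo α β, 0 < ‖f x - P‖ ^ 2 := fun x hx => by
    have := norm_pos_iff.2 (hd x hx); positivity
  have hApos : ∀ x ∈ Ioo α β, 0 < ‖f₁ x‖ ^ 2 := fun x hx => by
    have := norm_pos_iff.2 (h.ne_zero x hx); positivity
  have hD₁ : ∀ x ∈ Ioo α β, HasDerivAt (fun x => 2 * inner ℝ (f x - P) (f₁ x))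
      (2 * (‖f₁ x‖ ^ 2 + inner ℝ (f x - P) (f₂ x))) x := fun x hx =>
    (((hdd x hx).inner ℝ (h.deriv₂ x hx)).const_mul 2).congr_deriv (by
      rw [real_inner_self_eq_norm_sq]; ring)
  have hsq : ∀ x ∈ Ioo α β, gauge (‖f x - P‖ ^ 2) (‖f₁ x‖ ^ 2) ^ 2 = ‖f x - P‖ ^ 2 / ‖f₁ x‖ :=
    fun x hx => by rw [gauge_sq (hDpos x hx) (hApos x hx), Real.sqrt_sq (norm_nonneg _)]
  have hinv : ∀ {l : Filter ℝ}, Ioo α β ∈ l → Tendsto f l (𝓝 P) →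
      Tendsto (fun x => ‖invert (f x - P)‖) l atTop := by
    intro l hl hf
    have h1 : Tendsto (fun x => ‖f x - P‖) l (𝓝[>] 0) := by
      refine tendsto_nhdsWithin_iff.2 ⟨?_, eventually_of_mem hl fun x hx => norm_pos_iff.2 (hd x hx)⟩
      simpa using (hf.sub_const P).norm
    exact (tendsto_inv_nhdsGT_zero.comp h1).congr' (eventually_of_mem hl fun x hx =>
      (norm_invert (hd x hx)).symm)
  -- Here `g = ‖f - P‖ ‖f'‖^(-1/2)` and `R` is the inversion of `f - P`, so that `‖R'‖ = g⁻²`. The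
  -- identity gives `g'' + p g = g (Q + p - S/2)`.
  obtain ⟨heq, c, hc, huc⟩ := comparison hαβ (p := p) hu.pos hu.deriv₁ hu.deriv₂
    (fun x _ => gauge_pos (‖f x - P‖ ^ 2) (‖f₁ x‖ ^ 2))
    (fun x hx => hasDerivAt_gauge (hasDerivAt_norm_sq (hdd x hx))
      (hasDerivAt_norm_sq (h.deriv₂ x hx)) (hDpos x hx).ne' (hApos x hx).ne')
    (fun x hx => hasDerivAt_gauge_deriv (D := fun x => ‖f x - P‖ ^ 2) (A := fun x => ‖f₁ x‖ ^ 2)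
      (hasDerivAt_norm_sq (hdd x hx))
      (hasDerivAt_norm_sq (h.deriv₂ x hx)) (hD₁ x hx) (h.hasDerivAt_norm_sq_deriv hx)
      (hDpos x hx).ne' (hApos x hx).ne')
    (fun x hx => by
      rw [gauge_equation_identity (h.ne_zero x hx) (hd x hx)]
      have h1 := hS x hx
      have h2 := gauge_pos (‖f x - P‖ ^ 2) (‖f₁ x‖ ^ 2)
      rw [mul_comm (p x), ← mul_add]
      refine mul_nonneg h2.le ?_
      nlinarith [sq_nonneg ‖(‖f₁ x‖ / ‖f x - P‖ ^ 2) • orthPart (f₁ x) (f x - P) +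
        (2 * ‖f₁ x‖)⁻¹ • orthPart (f₁ x) (f₂ x)‖])
    (fun x hx => hasDerivAt_invert (hdd x hx) (hd x hx))
    (fun x hx => by
      rw [hsq x hx, norm_smul, norm_reflectAlong (hd x hx), norm_inv, norm_pow, norm_norm, inv_div,
        div_eq_inv_mul])
    (hinv (Ioo_mem_nhdsGT hαβ) hα) (hinv (Ioo_mem_nhdsLT hαβ) hβ)
  -- The sum of the nonnegative terms `Q` and `p - S/2` vanishes, so each of them does.
  have hboth : ∀ x ∈ Ioo α β, ‖(‖f₁ x‖ / ‖f x - P‖ ^ 2) • orthPart (f₁ x) (f x - P) +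
      (2 * ‖f₁ x‖)⁻¹ • orthPart (f₁ x) (f₂ x)‖ ^ 2 = 0 ∧
      ahlforsSchwarzian (f₁ x) (f₂ x) (f₃ x) = 2 * p x := by
    intro x hx
    have h0 := heq x hx
    rw [gauge_equation_identity (h.ne_zero x hx) (hd x hx), mul_comm (p x), ← mul_add] at h0
    have h1 := (mul_eq_zero.1 h0).resolve_left (gauge_pos _ _).ne'
    have h2 := hS x hx
    have h3 := sq_nonneg ‖(‖f₁ x‖ / ‖f x - P‖ ^ 2) • orthPart (f₁ x) (f x - P) +
      (2 * ‖f₁ x‖)⁻¹ • orthPart (f₁ x) (f₂ x)‖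
    constructor <;> linarith
  refine ⟨fun x hx => (hboth x hx).2, fun x hx => by simpa using (hboth x hx).1,
    c ^ 2, by positivity, fun x hx => ?_⟩
  have := (norm_pos_iff.2 (h.ne_zero x hx)).ne'
  rw [huc x hx, mul_pow, hsq x hx]
  field_simp

/-- Rigidity for a curve both of whose ends go to infinity. -/
theorem IsRegularCurve.rigid_infty (h : IsRegularCurve α β f f₁ f₂ f₃) (hαβ : α < β)
    (hu : IsPosSolution α β p u v)
    (hS : ∀ x ∈ Ioo α β, ahlforsSchwarzian (f₁ x) (f₂ x) (f₃ x) ≤ 2 * p x)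
    (hα : Tendsto (fun x => ‖f x‖) (𝓝[>] α) atTop)
    (hβ : Tendsto (fun x => ‖f x‖) (𝓝[<] β) atTop) :
    (∀ x ∈ Ioo α β, ahlforsSchwarzian (f₁ x) (f₂ x) (f₃ x) = 2 * p x) ∧
    ∀ x ∈ Ioo α β, orthPart (f₁ x) (f₂ x) = 0 := by
  have hApos : ∀ x ∈ Ioo α β, 0 < ‖f₁ x‖ ^ 2 := fun x hx => by
    have := norm_pos_iff.2 (h.ne_zero x hx); positivity
  have hsq : ∀ x ∈ Ioo α β, gauge 1 (‖f₁ x‖ ^ 2) ^ 2 = 1 / ‖f₁ x‖ :=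
    fun x hx => by rw [gauge_sq one_pos (hApos x hx), Real.sqrt_sq (norm_nonneg _)]
  have hid : ∀ x ∈ Ioo α β, (0 : ℝ) / (2 * 1) - 0 ^ 2 / (4 * 1 ^ 2)
      - 2 * (‖f₂ x‖ ^ 2 + inner ℝ (f₁ x) (f₃ x)) / (4 * ‖f₁ x‖ ^ 2)
      + 5 * (2 * inner ℝ (f₁ x) (f₂ x)) ^ 2 / (16 * (‖f₁ x‖ ^ 2) ^ 2)
      - 0 * (2 * inner ℝ (f₁ x) (f₂ x)) / (4 * 1 * ‖f₁ x‖ ^ 2) =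
      ‖(2 * ‖f₁ x‖)⁻¹ • orthPart (f₁ x) (f₂ x)‖ ^ 2 -
        1 / 2 * ahlforsSchwarzian (f₁ x) (f₂ x) (f₃ x) := fun x hx => by
    rw [← gauge_equation_identity_infty (h.ne_zero x hx)]; ring
  -- The choice `D = 1` gives `g = ‖f'‖^(-1/2)`; then `f` has speed `g⁻²` and needs no inversion.
  obtain ⟨heq, -⟩ := comparison hαβ (p := p) hu.pos hu.deriv₁ hu.deriv₂
    (fun x _ => gauge_pos 1 (‖f₁ x‖ ^ 2))
    (fun x hx => hasDerivAt_gauge (hasDerivAt_const x (1 : ℝ))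
      (hasDerivAt_norm_sq (h.deriv₂ x hx)) one_ne_zero (hApos x hx).ne')
    (fun x hx => hasDerivAt_gauge_deriv (D := fun _ => (1 : ℝ)) (D₁ := fun _ => (0 : ℝ))
      (A := fun x => ‖f₁ x‖ ^ 2) (hasDerivAt_const x (1 : ℝ))
      (hasDerivAt_norm_sq (h.deriv₂ x hx)) (hasDerivAt_const x (0 : ℝ))
      (h.hasDerivAt_norm_sq_deriv hx) one_ne_zero (hApos x hx).ne')
    (fun x hx => by
      rw [hid x hx]
      have h1 := hS x hx
      have h2 := gauge_pos 1 (‖f₁ x‖ ^ 2)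
      rw [mul_comm (p x), ← mul_add]
      refine mul_nonneg h2.le ?_
      nlinarith [sq_nonneg ‖(2 * ‖f₁ x‖)⁻¹ • orthPart (f₁ x) (f₂ x)‖])
    h.deriv₁ (fun x hx => by rw [hsq x hx]; simp) hα hβ
  have hboth : ∀ x ∈ Ioo α β, ‖(2 * ‖f₁ x‖)⁻¹ • orthPart (f₁ x) (f₂ x)‖ ^ 2 = 0 ∧
      ahlforsSchwarzian (f₁ x) (f₂ x) (f₃ x) = 2 * p x := by
    intro x hx
    have h0 := heq x hx
    rw [hid x hx, mul_comm (p x), ← mul_add] at h0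
    have h1 := (mul_eq_zero.1 h0).resolve_left (gauge_pos _ _).ne'
    have h2 := hS x hx
    have h3 := sq_nonneg ‖(2 * ‖f₁ x‖)⁻¹ • orthPart (f₁ x) (f₂ x)‖
    constructor <;> linarith
  refine ⟨fun x hx => (hboth x hx).2, fun x hx => ?_⟩
  have h1 := (hboth x hx).1
  have h2 := h.ne_zero x hx
  simpa [h2] using h1

/-- Rigidity on `(α, β)` gives `u² ‖f'‖ = c ‖f - f α‖²`. As `x → α` the right side tends to `0`, the
left side to a positive number because `α` is an interior point. The end `β = 1` is allowed, which
later excludes that `f` attains its boundary value. -/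
theorem IsRegularCurve.not_returns (h : IsRegularCurve (-1) 1 f f₁ f₂ f₃)
    (hu : IsPosSolution (-1) 1 p u v)
    (hS : ∀ x ∈ Ioo (-1 : ℝ) 1, ahlforsSchwarzian (f₁ x) (f₂ x) (f₃ x) ≤ 2 * p x)
    (hα : -1 < α) (hαβ : α < β) (hβ : β ≤ 1) (hne : ∀ x ∈ Ioo α β, f x ≠ f α)
    (ht : Tendsto f (𝓝[<] β) (𝓝 (f α))) : False := by
  have hαI : α ∈ Ioo (-1 : ℝ) 1 := ⟨hα, hαβ.trans_le hβ⟩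
  have hfc := (h.deriv₁ α hαI).continuousAt
  obtain ⟨-, -, c, hc, hcu⟩ := (h.mono hα.le hβ).rigid hαβ (hu.mono hα.le hβ) hne
    (fun x hx => hS x ⟨hα.trans hx.1, hx.2.trans_le hβ⟩) (hfc.tendsto.mono_left nhdsWithin_le_nhds) ht
  have h1 : Tendsto (fun x => u x ^ 2 * ‖f₁ x‖) (𝓝[>] α) (𝓝 (u α ^ 2 * ‖f₁ α‖)) :=
    ((((hu.deriv₁ α hαI).continuousAt.tendsto.pow 2).mul
      (h.deriv₂ α hαI).continuousAt.tendsto.norm)).mono_left nhdsWithin_le_nhds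
  have h2 : Tendsto (fun x => c * ‖f x - f α‖ ^ 2) (𝓝[>] α) (𝓝 (c * ‖f α - f α‖ ^ 2)) :=
    ((((hfc.tendsto.sub_const (f α)).norm.pow 2).const_mul c)).mono_left nhdsWithin_le_nhds
  have h3 := tendsto_nhds_unique (h1.congr' (eventually_of_mem (Ioo_mem_nhdsGT hαβ) hcu)) h2
  have h4 := hu.pos α hαI
  have h5 := norm_pos_iff.2 (h.ne_zero α hαI)
  rw [sub_self, norm_zero] at h3
  have : 0 < u α ^ 2 * ‖f₁ α‖ := by positivity
  simp at h3
  rcases h3 with h3 | h3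
  · linarith
  · exact h.ne_zero α hαI h3

theorem IsRegularCurve.injOn (h : IsRegularCurve (-1) 1 f f₁ f₂ f₃)
    (hu : IsPosSolution (-1) 1 p u v)
    (hS : ∀ x ∈ Ioo (-1 : ℝ) 1, ahlforsSchwarzian (f₁ x) (f₂ x) (f₃ x) ≤ 2 * p x) :
    InjOn f (Ioo (-1) 1) := by
  have key : ∀ a ∈ Ioo (-1 : ℝ) 1, ∀ b ∈ Ioo (-1 : ℝ) 1, a < b → f a ≠ f b := by
    intro a ha b hb hab hfab
    -- Because `f' a ≠ 0`, the curve leaves `f a` immediately; hence there is a first return `β`,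
    -- the least element of a compact set.
    have hev : ∀ᶠ x in 𝓝[>] a, f x ≠ f a :=
      ((h.deriv₁ a ha).eventually_ne (h.ne_zero a ha)).filter_mono
        (nhdsWithin_mono a fun x hx => ne_of_gt hx)
    obtain ⟨d, had, hd⟩ := (mem_nhdsGT_iff_exists_Ioo_subset).1 hev
    have had' : a < d := had
    have hdb : d ≤ b := by
      by_contra! hlt
      exact hd ⟨hab, hlt⟩ hfab.symm
    have hcont : ContinuousOn f (Icc d b) := fun x hx =>
      (h.deriv₁ x ⟨ha.1.trans (had'.trans_le hx.1), hx.2.trans_lt hb.2⟩).continuousAt.continuousWithinAt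
    have hcpt : IsCompact (Icc d b ∩ f ⁻¹' {f a}) :=
      isCompact_Icc.of_isClosed_subset (hcont.preimage_isClosed_of_isClosed isClosed_Icc
        isClosed_singleton) inter_subset_left
    obtain ⟨β, hβ⟩ := hcpt.exists_isLeast ⟨b, ⟨hdb, le_rfl⟩, hfab.symm⟩
    have hβI : β ∈ Ioo (-1 : ℝ) 1 :=
      ⟨ha.1.trans (had'.trans_le hβ.1.1.1), hβ.1.1.2.trans_lt hb.2⟩
    have hβf : f β = f a := hβ.1.2
    refine h.not_returns hu hS ha.1 (had'.trans_le hβ.1.1.1) hβI.2.le (fun x hx hfx => ?_) ?_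
    · rcases lt_or_ge x d with hxd | hxd
      · exact hd ⟨hx.1, hxd⟩ hfx
      · exact absurd (hβ.2 ⟨⟨hxd, hx.2.le.trans hβ.1.1.2⟩, hfx⟩) (not_le.2 hx.2)
    · rw [← hβf]
      exact (h.deriv₁ β hβI).continuousAt.tendsto.mono_left nhdsWithin_le_nhds
  intro a ha b hb hfab
  rcases lt_trichotomy a b with hlt | heq | hgt
  · exact absurd hfab (key a ha b hb hlt)
  · exact heq
  · exact absurd hfab.symm (key b hb a ha hgt)

theorem hasDerivAt_inv_norm {g : ℝ → E} {g' : E} {x : ℝ} (hg : HasDerivAt g g' x) (h0 : g x ≠ 0) :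
    HasDerivAt (fun x => ‖g x‖⁻¹) (-(inner ℝ (g x) g' / ‖g x‖ ^ 2) * ‖g x‖⁻¹) x := by
  have hn : ‖g x‖ ≠ 0 := norm_ne_zero_iff.2 h0
  have h1 := ((hasDerivAt_norm_sq hg).sqrt (by positivity)).inv (by simpa using h0)
  simp only [Pi.inv_def, Real.sqrt_sq (norm_nonneg _)] at h1
  refine h1.congr_deriv ?_
  field_simp

/-- The vector is the unit tangent of the inverted curve. The hypothesis `hQ` is `Q = 0`, which says
that this curve has no curvature. -/
theorem IsRegularCurve.direction_const (h : IsRegularCurve α β f f₁ f₂ f₃) {P : E}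
    (hP : ∀ x ∈ Ioo α β, f x ≠ P)
    (hQ : ∀ x ∈ Ioo α β, (‖f₁ x‖ / ‖f x - P‖ ^ 2) • orthPart (f₁ x) (f x - P) +
      (2 * ‖f₁ x‖)⁻¹ • orthPart (f₁ x) (f₂ x) = 0) {x : ℝ} (hx : x ∈ Ioo α β) :
    HasDerivAt (fun x => ‖f₁ x‖⁻¹ • reflectAlong (f x - P) (f₁ x)) 0 x := by
  have hd : f x - P ≠ 0 := sub_ne_zero.2 (hP x hx)
  have hdn : ‖f x - P‖ ≠ 0 := norm_ne_zero_iff.2 hd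
  have han : ‖f₁ x‖ ≠ 0 := norm_ne_zero_iff.2 (h.ne_zero x hx)
  have hdd : HasDerivAt (fun x => f x - P) (f₁ x) x := (h.deriv₁ x hx).sub_const P
  have hκ := (((hdd.inner ℝ (h.deriv₂ x hx)).const_mul 2).div (hasDerivAt_norm_sq hdd)
    (by positivity)).smul hdd
  have hr := (hasDerivAt_inv_norm (h.deriv₂ x hx) (h.ne_zero x hx)).smul ((h.deriv₂ x hx).sub hκ)
  refine hr.congr_deriv ?_
  simp only [Pi.div_apply, Pi.sub_apply, Pi.smul_apply', real_inner_self_eq_norm_sq]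
  have hq := hQ x hx
  generalize f₁ x = a at *
  generalize f₂ x = b at *
  generalize f x - P = d at *
  -- `hQ` solved for the second derivative; after substitution only multiples of `a` and `d` remain,
  -- and they cancel.
  have hb : b = (inner ℝ a b / ‖a‖ ^ 2 + 2 * inner ℝ d a / ‖d‖ ^ 2) • a
      - (2 * ‖a‖ ^ 2 / ‖d‖ ^ 2) • d := by
    have h1 : (2 * ‖a‖) • ((‖a‖ / ‖d‖ ^ 2) • orthPart a d + (2 * ‖a‖)⁻¹ • orthPart a b) = 0 := by
      rw [hq, smul_zero]
    rw [smul_add, smul_smul, smul_smul, mul_inv_cancel₀ (by positivity), one_smul, orthPart,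
      orthPart, real_inner_comm d a] at h1
    rw [← sub_eq_zero, ← h1, smul_sub, smul_smul]
    match_scalars <;> field_simp
    ring
  have hdb : inner ℝ d b = (inner ℝ a b / ‖a‖ ^ 2 + 2 * inner ℝ d a / ‖d‖ ^ 2) * inner ℝ d a
      - 2 * ‖a‖ ^ 2 := by
    conv_lhs => rw [hb]
    rw [inner_sub_right, real_inner_smul_right, real_inner_smul_right, real_inner_self_eq_norm_sq]
    field_simp
  rw [hdb]
  generalize inner ℝ a b = s at *
  rw [hb]
  match_scalars <;> field_simp <;> ring

/-- A curve on `(-1, 1)` that satisfies the Schwarzian bound and closes up at a finite point runs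
over a circle, with equality in the bound. -/
theorem IsRegularCurve.exists_circle (h : IsRegularCurve (-1) 1 f f₁ f₂ f₃)
    (hu : IsPosSolution (-1) 1 p u v)
    (hS : ∀ x ∈ Ioo (-1 : ℝ) 1, ahlforsSchwarzian (f₁ x) (f₂ x) (f₃ x) ≤ 2 * p x) {P : E}
    (hα : Tendsto f (𝓝[>] (-1)) (𝓝 P)) (hβ : Tendsto f (𝓝[<] 1) (𝓝 P)) :
    (∀ x ∈ Ioo (-1 : ℝ) 1, ahlforsSchwarzian (f₁ x) (f₂ x) (f₃ x) = 2 * p x) ∧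
    ∃ (c : E) (r : ℝ) (V : Submodule ℝ E), 0 < r ∧ Module.finrank ℝ V = 2 ∧
      P ∈ {x | x - c ∈ V ∧ ‖x - c‖ = r} ∧
      f '' Ioo (-1) 1 = {x | x - c ∈ V ∧ ‖x - c‖ = r} \ {P} := by
  have hαβ : (-1 : ℝ) < 1 := by norm_num
  have hP : ∀ x ∈ Ioo (-1 : ℝ) 1, f x ≠ P := by
    intro x hx hfx
    refine h.not_returns hu hS hx.1 hx.2 le_rfl (fun y hy hfy => ?_) (by rwa [hfx])
    exact hy.1.ne' (h.injOn hu hS ⟨hx.1.trans hy.1, hy.2⟩ hx hfy)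
  obtain ⟨hEq, hQ, -⟩ := h.rigid hαβ hu hP hS hα hβ
  refine ⟨hEq, ?_⟩
  have hd : ∀ x ∈ Ioo (-1 : ℝ) 1, f x - P ≠ 0 := fun x hx => sub_ne_zero.2 (hP x hx)
  have h0 : (0 : ℝ) ∈ Ioo (-1 : ℝ) 1 := by norm_num
  set e : E := ‖f₁ 0‖⁻¹ • reflectAlong (f 0 - P) (f₁ 0) with he
  have hconst : ∀ x ∈ Ioo (-1 : ℝ) 1, ‖f₁ x‖⁻¹ • reflectAlong (f x - P) (f₁ x) = e := fun x hx =>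
    isOpen_Ioo.is_const_of_deriv_eq_zero (𝕜 := ℝ) isPreconnected_Ioo
      (f := fun x => ‖f₁ x‖⁻¹ • reflectAlong (f x - P) (f₁ x))
      (fun y hy => (h.direction_const hP hQ hy).differentiableAt.differentiableWithinAt)
      (fun y hy => (h.direction_const hP hQ hy).deriv) hx h0
  have he1 : ‖e‖ = 1 := by
    rw [he, norm_smul, norm_reflectAlong (hd 0 h0), norm_inv, norm_norm,
      inv_mul_cancel₀ (norm_ne_zero_iff.2 (h.ne_zero 0 h0))]
  have hinv : ∀ {l : Filter ℝ}, Ioo (-1 : ℝ) 1 ∈ l → Tendsto f l (𝓝 P) →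
      Tendsto (fun x => ‖invert (f x - P)‖) l atTop := by
    intro l hl hf
    have h1 : Tendsto (fun x => ‖f x - P‖) l (𝓝[>] 0) := by
      refine tendsto_nhdsWithin_iff.2 ⟨?_, eventually_of_mem hl fun x hx => norm_pos_iff.2 (hd x hx)⟩
      simpa using (hf.sub_const P).norm
    exact (tendsto_inv_nhdsGT_zero.comp h1).congr' (eventually_of_mem hl fun x hx =>
      (norm_invert (hd x hx)).symm)
  obtain ⟨q, hqe, hq⟩ := image_eq_line hαβ (R := fun x => invert (f x - P))
    (ρ := fun x => (‖f x - P‖ ^ 2)⁻¹ * ‖f₁ x‖) he1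
    (fun x hx => by
      have h1 := norm_pos_iff.2 (hd x hx)
      have h2 := norm_pos_iff.2 (h.ne_zero x hx)
      positivity)
    (fun x hx => (hasDerivAt_invert ((h.deriv₁ x hx).sub_const P) (hd x hx)).congr_deriv (by
      rw [← hconst x hx, smul_smul, mul_assoc,
        mul_inv_cancel₀ (norm_ne_zero_iff.2 (h.ne_zero x hx)), mul_one]))
    (hinv (Ioo_mem_nhdsGT hαβ) hα) (hinv (Ioo_mem_nhdsLT hαβ) hβ)
  -- An inverted vector never vanishes, so the line misses the origin and its inversion is a circle,
  -- not a line.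
  have hq0 : q ≠ 0 := by
    rintro rfl
    obtain ⟨x, hx, hx0⟩ : (0 : E) ∈ (fun x => invert (f x - P)) '' Ioo (-1) 1 := by
      rw [hq]; exact ⟨0, by simp⟩
    exact invert_ne_zero (hd x hx) hx0
  obtain ⟨c, r, V, hr, hV, hPV, him⟩ := invert_image_line P he1 hq0 hqe
  refine ⟨c, r, V, hr, hV, hPV, ?_⟩
  rw [← him, ← hq, image_image]
  exact image_congr fun x hx => by rw [invert_invert (hd x hx)]; simp

/-- A curve on `(-1, 1)` that satisfies the Schwarzian bound and closes up at infinity runs over a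
line, with equality in the bound. -/
theorem IsRegularCurve.exists_line (h : IsRegularCurve (-1) 1 f f₁ f₂ f₃)
    (hu : IsPosSolution (-1) 1 p u v)
    (hS : ∀ x ∈ Ioo (-1 : ℝ) 1, ahlforsSchwarzian (f₁ x) (f₂ x) (f₃ x) ≤ 2 * p x)
    (hα : Tendsto (fun x => ‖f x‖) (𝓝[>] (-1)) atTop)
    (hβ : Tendsto (fun x => ‖f x‖) (𝓝[<] 1) atTop) :
    (∀ x ∈ Ioo (-1 : ℝ) 1, ahlforsSchwarzian (f₁ x) (f₂ x) (f₃ x) = 2 * p x) ∧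
    ∃ q e : E, e ≠ 0 ∧ f '' Ioo (-1) 1 = {y | ∃ s : ℝ, y = q + s • e} := by
  have hαβ : (-1 : ℝ) < 1 := by norm_num
  obtain ⟨hEq, hQ⟩ := h.rigid_infty hαβ hu hS hα hβ
  refine ⟨hEq, ?_⟩
  have h0 : (0 : ℝ) ∈ Ioo (-1 : ℝ) 1 := by norm_num
  have hdir : ∀ x ∈ Ioo (-1 : ℝ) 1, HasDerivAt (fun x => ‖f₁ x‖⁻¹ • f₁ x) 0 x := by
    intro x hx
    refine ((hasDerivAt_inv_norm (h.deriv₂ x hx) (h.ne_zero x hx)).smul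
      (h.deriv₂ x hx)).congr_deriv ?_
    have hq := hQ x hx
    rw [orthPart, sub_eq_zero] at hq
    rw [neg_mul, neg_smul, mul_comm, mul_smul, ← hq, add_neg_cancel]
  set e : E := ‖f₁ 0‖⁻¹ • f₁ 0 with he
  have hconst : ∀ x ∈ Ioo (-1 : ℝ) 1, ‖f₁ x‖⁻¹ • f₁ x = e := fun x hx =>
    isOpen_Ioo.is_const_of_deriv_eq_zero (𝕜 := ℝ) isPreconnected_Ioo
      (f := fun x => ‖f₁ x‖⁻¹ • f₁ x)
      (fun y hy => (hdir y hy).differentiableAt.differentiableWithinAt)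
      (fun y hy => (hdir y hy).deriv) hx h0
  have he1 : ‖e‖ = 1 := by
    rw [he, norm_smul, norm_inv, norm_norm,
      inv_mul_cancel₀ (norm_ne_zero_iff.2 (h.ne_zero 0 h0))]
  obtain ⟨q, -, hq⟩ := image_eq_line hαβ (ρ := fun x => ‖f₁ x‖) he1
    (fun x hx => norm_pos_iff.2 (h.ne_zero x hx))
    (fun x hx => (h.deriv₁ x hx).congr_deriv (by
      rw [← hconst x hx, smul_smul,
        mul_inv_cancel₀ (norm_ne_zero_iff.2 (h.ne_zero x hx)), one_smul])) hα hβ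
  exact ⟨q, e, by rw [← norm_ne_zero_iff, he1]; exact one_ne_zero, hq⟩

end Curves

/-! ### Hermitian algebra of the Schwarzian and the curvature. -/

section Hermitian

open ComplexConjugate

variable {n : ℕ}

theorem real_inner_eq_re (x y : EuclideanSpace ℂ (Fin n)) :
    inner ℝ x y = (inner ℂ x y : ℂ).re := by
  simp only [PiLp.inner_apply, Complex.re_sum]
  refine Finset.sum_congr rfl fun i _ => ?_
  simp [real_inner_eq_re_inner ℂ]

theorem norm_sq_cast (a : EuclideanSpace ℂ (Fin n)) : ((‖a‖ : ℂ)) ^ 2 = inner ℂ a a :=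
  (inner_self_eq_norm_sq_to_K a).symm

/-- The Schwarzian of a holomorphic curve in terms of its first three derivatives. -/
def hermSchwarzian (a b c : EuclideanSpace ℂ (Fin n)) : ℂ :=
  inner ℂ a c / ‖a‖ ^ 2 - 3 / 2 * (inner ℂ a b / ‖a‖ ^ 2) ^ 2

/-- The Laplacian of `log |a|` in terms of `a` and its derivative `b`. -/
def hermCurvature (a b : EuclideanSpace ℂ (Fin n)) : ℝ :=
  2 * (‖b‖ ^ 2 / ‖a‖ ^ 2 - ‖(inner ℂ a b : ℂ)‖ ^ 2 / ‖a‖ ^ 4)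

/-- With `w = ⟨a, b⟩`, the terms `-3/2 Re w²` and `-3/2 |w|²` add up to `-3 (Re w)²`. This is the
source of the factor `3/4` in the criterion. -/
theorem ahlforsSchwarzian_eq {a : EuclideanSpace ℂ (Fin n)} (ha : a ≠ 0)
    (b c : EuclideanSpace ℂ (Fin n)) :
    ahlforsSchwarzian a b c = (hermSchwarzian a b c).re + 3 / 4 * hermCurvature a b := by
  have han : ‖a‖ ≠ 0 := norm_ne_zero_iff.2 ha
  have h1 : (hermSchwarzian a b c).re = (inner ℂ a c : ℂ).re / ‖a‖ ^ 2 -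
      3 / 2 * ((inner ℂ a b : ℂ).re ^ 2 - (inner ℂ a b : ℂ).im ^ 2) / ‖a‖ ^ 4 := by
    have h2 : hermSchwarzian a b c = inner ℂ a c / ((‖a‖ ^ 2 : ℝ) : ℂ) -
        ((3 / 2 : ℝ) : ℂ) * (inner ℂ a b * inner ℂ a b) / ((‖a‖ ^ 4 : ℝ) : ℂ) := by
      rw [hermSchwarzian]
      have : (‖a‖ : ℂ) ≠ 0 := by exact_mod_cast han
      push_cast
      field_simp
    rw [h2, Complex.sub_re, Complex.div_ofReal_re, Complex.div_ofReal_re, Complex.re_ofReal_mul,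
      Complex.mul_re]
    ring
  rw [h1, ahlforsSchwarzian, hermCurvature, real_inner_eq_re, real_inner_eq_re, Complex.sq_norm,
    Complex.normSq_apply]
  field_simp
  ring

theorem hermCurvature_cast (a b : EuclideanSpace ℂ (Fin n)) : (hermCurvature a b : ℂ) =
    2 * (inner ℂ b b / inner ℂ a a - inner ℂ a b * inner ℂ b a / inner ℂ a a ^ 2) := by
  rw [hermCurvature]
  push_cast
  rw [← norm_sq_cast a, ← norm_sq_cast b, ← inner_conj_symm b a, Complex.mul_conj,
    Complex.normSq_eq_norm_sq]
  push_cast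
  ring

/-- The arguments are the derivatives of `φ ∘ γ`, where `t`, `s`, `r` are those of `γ`. The
condition `hr` says that `γ` has zero Schwarzian, so the chain rule adds no term. -/
theorem hermSchwarzian_reparam {a : EuclideanSpace ℂ (Fin n)} (ha : a ≠ 0)
    (b c : EuclideanSpace ℂ (Fin n)) {t s r : ℂ} (ht : t ≠ 0) (hr : r = 3 / 2 * s ^ 2 / t) :
    hermSchwarzian (t • a) (t ^ 2 • b + s • a) (t ^ 3 • c + (3 * t * s) • b + r • a) =
      t ^ 2 * hermSchwarzian a b c := by
  have h0 : (inner ℂ a a : ℂ) ≠ 0 := inner_self_ne_zero.2 ha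
  have hc : conj t ≠ 0 := by simpa using ht
  simp only [hermSchwarzian, norm_sq_cast, inner_smul_left, inner_smul_right, inner_add_right]
  rw [hr]
  field_simp
  ring

theorem hermCurvature_reparam {a : EuclideanSpace ℂ (Fin n)} (ha : a ≠ 0)
    (b : EuclideanSpace ℂ (Fin n)) {t s : ℂ} (ht : t ≠ 0) :
    hermCurvature (t • a) (t ^ 2 • b + s • a) = ‖t‖ ^ 2 * hermCurvature a b := by
  have h0 : (inner ℂ a a : ℂ) ≠ 0 := inner_self_ne_zero.2 ha
  have hc : conj t ≠ 0 := by simpa using ht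
  have key : (hermCurvature (t • a) (t ^ 2 • b + s • a) : ℂ) =
      ((‖t‖ ^ 2 * hermCurvature a b : ℝ) : ℂ) := by
    push_cast
    rw [← Complex.conj_mul', hermCurvature_cast, hermCurvature_cast]
    simp only [inner_smul_left, inner_smul_right, inner_add_right, inner_add_left, map_pow]
    field_simp
    ring
  exact_mod_cast key

theorem ahlforsSchwarzian_reparam_le {a : EuclideanSpace ℂ (Fin n)} (ha : a ≠ 0)
    (b c : EuclideanSpace ℂ (Fin n)) {t s r : ℂ} (ht : t ≠ 0) (hr : r = 3 / 2 * s ^ 2 / t) :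
    ahlforsSchwarzian (t • a) (t ^ 2 • b + s • a) (t ^ 3 • c + (3 * t * s) • b + r • a) ≤
      ‖t‖ ^ 2 * (‖hermSchwarzian a b c‖ + 3 / 4 * |hermCurvature a b|) := by
  rw [ahlforsSchwarzian_eq (smul_ne_zero ht ha), hermSchwarzian_reparam ha b c ht hr,
    hermCurvature_reparam ha b ht]
  have h1 := Complex.re_le_norm (t ^ 2 * hermSchwarzian a b c)
  rw [norm_mul, norm_pow] at h1
  have h2 := mul_le_mul_of_nonneg_left (le_abs_self (hermCurvature a b)) (sq_nonneg ‖t‖)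
  linarith

end Hermitian

/-! ### Wirtinger derivatives of `σ`. -/

section Wirtinger

open ComplexConjugate

variable {n : ℕ} {a b c : ℂ → EuclideanSpace ℂ (Fin n)}

theorem hasFDerivAt_half_log_norm_sq {z : ℂ} (ha : HasDerivAt a (b z) z) (h0 : a z ≠ 0) :
    HasFDerivAt (fun w => (1 / 2 : ℝ) * Real.log (‖a w‖ ^ 2))
      (Complex.reCLM.comp ((inner ℂ (a z) (b z) / (‖a z‖ : ℂ) ^ 2) •
        ContinuousLinearMap.id ℝ ℂ)) z := by
  have hN : ‖a z‖ ^ 2 ≠ 0 := by simpa using h0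
  have h1 := ((ha.hasFDerivAt.restrictScalars ℝ).norm_sq.log hN).const_mul (1 / 2 : ℝ)
  refine h1.congr_fderiv (ContinuousLinearMap.ext fun v => ?_)
  have h2 : inner ℂ (a z) (b z) / (‖a z‖ : ℂ) ^ 2 * v =
      (inner ℂ (a z) (b z) * v) / ((‖a z‖ ^ 2 : ℝ) : ℂ) := by push_cast; ring
  simp only [_root_.smul_apply, ContinuousLinearMap.comp_apply,
    ContinuousLinearMap.id_apply, Complex.reCLM_apply, smul_eq_mul, h2, Complex.div_ofReal_re]
  simp [real_inner_eq_re]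
  field_simp

/-- The function is `2 σ_z`. In its differential the coefficient of `v` yields `σ_zz`, hence the
Schwarzian, and that of `conj v` yields the Laplacian. -/
theorem hasFDerivAt_inner_div_norm_sq {z : ℂ} (ha : HasDerivAt a (b z) z)
    (hb : HasDerivAt b (c z) z) (h0 : a z ≠ 0) :
    ∃ L : ℂ →L[ℝ] ℂ, HasFDerivAt (fun w => inner ℂ (a w) (b w) / (‖a w‖ : ℂ) ^ 2) L z ∧
      ∀ v, L v = (conj v * inner ℂ (b z) (b z) + v * inner ℂ (a z) (c z)) / inner ℂ (a z) (a z) -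
        inner ℂ (a z) (b z) * (v * inner ℂ (a z) (b z) + conj v * inner ℂ (b z) (a z)) /
          inner ℂ (a z) (a z) ^ 2 := by
  have hN : (inner ℂ (a z) (a z) : ℂ) ≠ 0 := inner_self_ne_zero.2 h0
  have ha' := ha.hasFDerivAt.restrictScalars ℝ
  have hb' := hb.hasFDerivAt.restrictScalars ℝ
  have h1 := (ha'.inner ℂ hb').mul ((hasDerivAt_inv hN).hasFDerivAt.restrictScalars ℝ |>.comp z
    (ha'.inner ℂ ha'))
  simp only [norm_sq_cast]
  refine ⟨_, h1, fun v => ?_⟩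
  simp [inner_smul_right, inner_smul_left]
  field_simp
  ring

variable {φ : ℂ → EuclideanSpace ℂ (Fin n)}

theorem sigma_eq (φ : ℂ → EuclideanSpace ℂ (Fin n)) :
    sigma φ = fun w => (1 / 2 : ℝ) * Real.log (‖deriv φ w‖ ^ 2) := by
  ext w
  rw [sigma, EuclideanSpace.norm_sq_eq]

theorem hasDerivAt_of_differentiableOn_ball {X : Type*} [NormedAddCommGroup X] [NormedSpace ℂ X]
    {g : ℂ → X} (hg : DifferentiableOn ℂ g (Metric.ball 0 1)) {z : ℂ}
    (hz : z ∈ Metric.ball (0 : ℂ) 1) : HasDerivAt g (deriv g z) z :=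
  (hg.differentiableAt (Metric.isOpen_ball.mem_nhds hz)).hasDerivAt

/-- `σ_z` in terms of the derivatives of the curve. -/
theorem dz_sigma (hφ : DifferentiableOn ℂ φ (Metric.ball 0 1))
    (hφ' : ∀ z ∈ Metric.ball (0 : ℂ) 1, deriv φ z ≠ 0) {z : ℂ}
    (hz : z ∈ Metric.ball (0 : ℂ) 1) :
    dz (fun w => (sigma φ w : ℂ)) z =
      1 / 2 * (inner ℂ (deriv φ z) (deriv (deriv φ) z) / (‖deriv φ z‖ : ℂ) ^ 2) := by
  have h1 := Complex.ofRealCLM.hasFDerivAt.comp z (hasFDerivAt_half_log_norm_sq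
    (hasDerivAt_of_differentiableOn_ball (hφ.deriv Metric.isOpen_ball) hz) (hφ' z hz))
  rw [← sigma_eq] at h1
  have h2 : fderiv ℝ (fun w => (sigma φ w : ℂ)) z = _ := h1.fderiv
  rw [dz, h2]
  generalize inner ℂ (deriv φ z) (deriv (deriv φ) z) / (‖deriv φ z‖ : ℂ) ^ 2 = κ
  apply Complex.ext <;> simp

theorem schwarzian_eq (hφ : DifferentiableOn ℂ φ (Metric.ball 0 1))
    (hφ' : ∀ z ∈ Metric.ball (0 : ℂ) 1, deriv φ z ≠ 0) {z : ℂ}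
    (hz : z ∈ Metric.ball (0 : ℂ) 1) :
    schwarzian φ z =
      hermSchwarzian (deriv φ z) (deriv (deriv φ) z) (deriv (deriv (deriv φ)) z) := by
  have hφ₁ := hφ.deriv Metric.isOpen_ball
  have hφ₂ := hφ₁.deriv Metric.isOpen_ball
  obtain ⟨L, hL, hLv⟩ := hasFDerivAt_inner_div_norm_sq (hasDerivAt_of_differentiableOn_ball hφ₁ hz)
    (hasDerivAt_of_differentiableOn_ball hφ₂ hz) (hφ' z hz)
  have hev : (dz fun w => (sigma φ w : ℂ)) =ᶠ[𝓝 z] fun w =>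
      1 / 2 * (inner ℂ (deriv φ w) (deriv (deriv φ) w) / (‖deriv φ w‖ : ℂ) ^ 2) :=
    eventually_of_mem (Metric.isOpen_ball.mem_nhds hz) fun w hw => dz_sigma hφ hφ' hw
  have hN : (inner ℂ (deriv φ z) (deriv φ z) : ℂ) ≠ 0 := inner_self_ne_zero.2 (hφ' z hz)
  rw [schwarzian, dz_sigma hφ hφ' hz, dz, hev.fderiv_eq, (hL.const_mul (1 / 2 : ℂ)).fderiv]
  simp only [_root_.smul_apply, hLv, map_one, Complex.conj_I, hermSchwarzian,
    norm_sq_cast, smul_eq_mul]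
  field_simp
  ring_nf
  simp only [Complex.I_sq]
  ring

theorem laplacian_sigma_eq (hφ : DifferentiableOn ℂ φ (Metric.ball 0 1))
    (hφ' : ∀ z ∈ Metric.ball (0 : ℂ) 1, deriv φ z ≠ 0) {z : ℂ}
    (hz : z ∈ Metric.ball (0 : ℂ) 1) :
    Laplacian.laplacian (sigma φ) z = hermCurvature (deriv φ z) (deriv (deriv φ) z) := by
  have hφ₁ := hφ.deriv Metric.isOpen_ball
  have hφ₂ := hφ₁.deriv Metric.isOpen_ball
  obtain ⟨L, hL, hLv⟩ := hasFDerivAt_inner_div_norm_sq (hasDerivAt_of_differentiableOn_ball hφ₁ hz)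
    (hasDerivAt_of_differentiableOn_ball hφ₂ hz) (hφ' z hz)
  have hev : fderiv ℝ (sigma φ) =ᶠ[𝓝 z] fun w => Complex.reCLM.comp
      ((inner ℂ (deriv φ w) (deriv (deriv φ) w) / (‖deriv φ w‖ : ℂ) ^ 2) •
        ContinuousLinearMap.id ℝ ℂ) :=
    eventually_of_mem (Metric.isOpen_ball.mem_nhds hz) fun w hw => by
      rw [sigma_eq]
      exact (hasFDerivAt_half_log_norm_sq (hasDerivAt_of_differentiableOn_ball hφ₁ hw)
        (hφ' w hw)).fderiv
  have hsecond : ∀ v, iteratedFDeriv ℝ 2 (sigma φ) z ![v, v] = (L v * v).re := by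
    intro v
    rw [iteratedFDeriv_two_apply, hev.fderiv_eq]
    have h1 := (((ContinuousLinearMap.compL ℝ ℂ ℂ ℝ) Complex.reCLM).hasFDerivAt).comp z
      (hL.smul_const (ContinuousLinearMap.id ℝ ℂ))
    have h2 : fderiv ℝ (fun w => Complex.reCLM.comp
      ((inner ℂ (deriv φ w) (deriv (deriv φ) w) / (‖deriv φ w‖ : ℂ) ^ 2) •
        ContinuousLinearMap.id ℝ ℂ)) z = _ := h1.fderiv
    rw [h2]
    simp
  rw [InnerProductSpace.laplacian_eq_iteratedFDeriv_complexPlane]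
  simp only [hsecond]
  have hN : (inner ℂ (deriv φ z) (deriv φ z) : ℂ) ≠ 0 := inner_self_ne_zero.2 (hφ' z hz)
  -- For `L v = α v + β conj v` this sum is `2 β`.
  have key : L 1 * 1 + L Complex.I * Complex.I =
      (hermCurvature (deriv φ z) (deriv (deriv φ) z) : ℂ) := by
    rw [hermCurvature_cast, hLv, hLv]
    simp only [map_one, Complex.conj_I]
    field_simp
    ring_nf
    simp only [Complex.I_sq]
    ring
  rw [← Complex.add_re, key, Complex.ofReal_re]

theorem criterionLHS_eq (hφ : DifferentiableOn ℂ φ (Metric.ball 0 1))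
    (hφ' : ∀ z ∈ Metric.ball (0 : ℂ) 1, deriv φ z ≠ 0) {z : ℂ}
    (hz : z ∈ Metric.ball (0 : ℂ) 1) :
    criterionLHS φ z =
      ‖hermSchwarzian (deriv φ z) (deriv (deriv φ) z) (deriv (deriv (deriv φ)) z)‖ +
        3 / 4 * |hermCurvature (deriv φ z) (deriv (deriv φ) z)| := by
  have hN : 0 < ‖deriv φ z‖ ^ 2 := by
    have := norm_pos_iff.2 (hφ' z hz); positivity
  have hexp : Real.exp (-2 * sigma φ z) = (‖deriv φ z‖ ^ 2)⁻¹ := by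
    have h1 : -2 * sigma φ z = -Real.log (‖deriv φ z‖ ^ 2) := by rw [sigma_eq]; ring
    rw [h1, Real.exp_neg, Real.exp_log hN]
  rw [criterionLHS, gaussCurvature, schwarzian_eq hφ hφ' hz, laplacian_sigma_eq hφ hφ' hz, hexp,
    abs_neg, abs_mul, abs_of_pos (inv_pos.2 hN), mul_assoc (3 / 4 : ℝ), mul_inv_cancel_left₀ hN.ne']

end Wirtinger

/-! ### Geodesics of the disk, parametrized by Möbius maps. -/

section Geodesics

open ComplexConjugate

/-- The hyperbolic geodesic of the unit disk, parametrized on `(-1, 1)`, that passes through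
`c t I` perpendicularly to the radius, for `‖c‖ = 1` and `|t| < 1`. -/
def geodesic (c : ℂ) (t x : ℝ) : ℂ := c * (x + t * Complex.I) / (1 - t * x * Complex.I)

/-- The first derivative of `geodesic c t`. -/
def geodesic₁ (c : ℂ) (t x : ℝ) : ℂ := c * (1 - t ^ 2) / (1 - t * x * Complex.I) ^ 2

/-- The second derivative of `geodesic c t`. -/
def geodesic₂ (c : ℂ) (t x : ℝ) : ℂ :=
  2 * (t * Complex.I) * c * (1 - t ^ 2) / (1 - t * x * Complex.I) ^ 3

/-- The third derivative of `geodesic c t`. -/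
def geodesic₃ (c : ℂ) (t x : ℝ) : ℂ :=
  6 * (t * Complex.I) ^ 2 * c * (1 - t ^ 2) / (1 - t * x * Complex.I) ^ 4

theorem geodesic_denom_ne_zero (t x : ℝ) : (1 - t * x * Complex.I : ℂ) ≠ 0 := by
  intro h
  have := congrArg Complex.re h
  simp at this

theorem hasDerivAt_geodesic_denom (t x : ℝ) :
    HasDerivAt (fun x : ℝ => (1 - t * x * Complex.I : ℂ)) (-(t * Complex.I)) x := by
  have h : HasDerivAt (fun x : ℝ => (x : ℂ)) 1 x := Complex.ofRealCLM.hasDerivAt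
  exact (((h.const_mul (t : ℂ)).mul_const Complex.I).const_sub 1).congr_deriv (by ring)

theorem hasDerivAt_geodesic (c : ℂ) (t x : ℝ) :
    HasDerivAt (geodesic c t) (geodesic₁ c t x) x := by
  have h : HasDerivAt (fun x : ℝ => (x : ℂ)) 1 x := Complex.ofRealCLM.hasDerivAt
  have h0 := geodesic_denom_ne_zero t x
  refine (((h.add_const (t * Complex.I : ℂ)).const_mul c).div (hasDerivAt_geodesic_denom t x)
    h0).congr_deriv ?_
  rw [geodesic₁]
  congr 1
  linear_combination c * t ^ 2 * Complex.I_sq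

theorem hasDerivAt_geodesic₁ (c : ℂ) (t x : ℝ) :
    HasDerivAt (geodesic₁ c t) (geodesic₂ c t x) x := by
  have h0 := geodesic_denom_ne_zero t x
  refine ((hasDerivAt_const x (c * (1 - t ^ 2) : ℂ)).div ((hasDerivAt_geodesic_denom t x).pow 2)
    (pow_ne_zero 2 h0)).congr_deriv ?_
  simp only [geodesic₂, Pi.pow_apply]
  field_simp
  push_cast
  ring

theorem hasDerivAt_geodesic₂ (c : ℂ) (t x : ℝ) :
    HasDerivAt (geodesic₂ c t) (geodesic₃ c t x) x := by
  have h0 := geodesic_denom_ne_zero t x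
  refine ((hasDerivAt_const x (2 * (t * Complex.I) * c * (1 - t ^ 2) : ℂ)).div
    ((hasDerivAt_geodesic_denom t x).pow 3) (pow_ne_zero 3 h0)).congr_deriv ?_
  simp only [geodesic₃, Pi.pow_apply]
  field_simp
  push_cast
  ring

theorem geodesic₁_ne_zero {c : ℂ} (hc : ‖c‖ = 1) {t : ℝ} (ht : t ^ 2 < 1) (x : ℝ) :
    geodesic₁ c t x ≠ 0 := by
  have hc0 : c ≠ 0 := by rw [← norm_ne_zero_iff, hc]; exact one_ne_zero
  have h1 : (1 - t ^ 2 : ℂ) ≠ 0 := by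
    have : (1 - t ^ 2 : ℝ) ≠ 0 := by linarith
    exact_mod_cast this
  exact div_ne_zero (mul_ne_zero hc0 h1) (pow_ne_zero 2 (geodesic_denom_ne_zero t x))

theorem geodesic₃_eq {c : ℂ} (hc : ‖c‖ = 1) {t : ℝ} (ht : t ^ 2 < 1) (x : ℝ) :
    geodesic₃ c t x = 3 / 2 * geodesic₂ c t x ^ 2 / geodesic₁ c t x := by
  have h0 := geodesic_denom_ne_zero t x
  have h1 := geodesic₁_ne_zero hc ht x
  rw [eq_div_iff h1, geodesic₁, geodesic₂, geodesic₃]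
  field_simp
  ring

theorem normSq_geodesic_denom (t x : ℝ) :
    Complex.normSq (1 - t * x * Complex.I : ℂ) = 1 + t ^ 2 * x ^ 2 := by
  simp [Complex.normSq_apply]; ring

theorem norm_geodesic_sq {c : ℂ} (hc : ‖c‖ = 1) (t x : ℝ) :
    ‖geodesic c t x‖ ^ 2 = (x ^ 2 + t ^ 2) / (1 + t ^ 2 * x ^ 2) := by
  rw [geodesic, norm_div, norm_mul, hc, one_mul, div_pow, Complex.sq_norm, Complex.sq_norm,
    normSq_geodesic_denom]
  congr 1
  simp [Complex.normSq_apply]; ring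

theorem norm_geodesic₁ {c : ℂ} (hc : ‖c‖ = 1) {t : ℝ} (ht : t ^ 2 < 1) (x : ℝ) :
    ‖geodesic₁ c t x‖ = (1 - t ^ 2) / (1 + t ^ 2 * x ^ 2) := by
  rw [geodesic₁, norm_div, norm_mul, hc, one_mul, norm_pow, Complex.sq_norm, normSq_geodesic_denom]
  congr 1
  have : (1 - t ^ 2 : ℂ) = ((1 - t ^ 2 : ℝ) : ℂ) := by push_cast; ring
  rw [this, Complex.norm_real, Real.norm_eq_abs, abs_of_pos (by linarith)]

/-- Equality in the Schwarz–Pick lemma: `geodesic c t` is the restriction to `(-1, 1)` of a disk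
automorphism. -/
theorem one_sub_norm_geodesic_sq {c : ℂ} (hc : ‖c‖ = 1) {t : ℝ} (ht : t ^ 2 < 1) (x : ℝ) :
    1 - ‖geodesic c t x‖ ^ 2 = ‖geodesic₁ c t x‖ * (1 - x ^ 2) := by
  rw [norm_geodesic_sq hc, norm_geodesic₁ hc ht]
  have : 1 + t ^ 2 * x ^ 2 ≠ 0 := by positivity
  field_simp
  ring

theorem geodesic_mem_ball {c : ℂ} (hc : ‖c‖ = 1) {t : ℝ} (ht : t ^ 2 < 1) {x : ℝ}
    (hx : x ∈ Ioo (-1 : ℝ) 1) : geodesic c t x ∈ Metric.ball (0 : ℂ) 1 := by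
  have h1 := one_sub_norm_geodesic_sq hc ht x
  have h2 : 0 < 1 - x ^ 2 := by nlinarith [hx.1, hx.2]
  have h3 := norm_pos_iff.2 (geodesic₁_ne_zero hc ht x)
  have h4 := mul_pos h3 h2
  rw [mem_ball_zero_iff]
  nlinarith [norm_nonneg (geodesic c t x)]

theorem abs_le_norm_geodesic {c : ℂ} (hc : ‖c‖ = 1) {t x : ℝ}
    (hx : x ∈ Ioo (-1 : ℝ) 1) : |x| ≤ ‖geodesic c t x‖ := by
  have h2 : 0 < 1 - x ^ 2 := by nlinarith [hx.1, hx.2]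
  rw [← abs_norm (geodesic c t x), ← sq_le_sq, norm_geodesic_sq hc, le_div_iff₀ (by positivity)]
  nlinarith [mul_nonneg (sq_nonneg t) (mul_nonneg h2.le (by positivity : 0 ≤ 1 + x ^ 2))]

/-- The monotonicity of `(1 - x²)² p`, applied to `|x| ≤ |γ|`, is the desired bound after division
by `(1 - x²)²`. -/
theorem IsNehari.geodesic_le {p : ℝ → ℝ} (hp : IsNehari p) {c : ℂ} (hc : ‖c‖ = 1) {t : ℝ}
    (ht : t ^ 2 < 1) {x : ℝ} (hx : x ∈ Ioo (-1 : ℝ) 1) :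
    ‖geodesic₁ c t x‖ ^ 2 * p ‖geodesic c t x‖ ≤ p x := by
  have h2 : 0 < 1 - x ^ 2 := by nlinarith [hx.1, hx.2]
  have hb := geodesic_mem_ball hc ht hx
  rw [mem_ball_zero_iff] at hb
  have h3 := hp.antitoneOn ⟨abs_nonneg x, abs_lt.2 hx⟩ ⟨norm_nonneg _, hb⟩
    (abs_le_norm_geodesic hc (t := t) hx)
  simp only at h3
  have hpx : p |x| = p x := by
    rcases abs_choice x with h | h <;> rw [h]
    exact hp.even x hx
  rw [one_sub_norm_geodesic_sq hc ht, sq_abs, hpx, mul_pow] at h3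
  have h4 : 0 < (1 - x ^ 2) ^ 2 := by positivity
  nlinarith

theorem exists_geodesic_endpoints {ζ₁ ζ₂ : ℂ} (h₁ : ‖ζ₁‖ = 1) (h₂ : ‖ζ₂‖ = 1) (hne : ζ₁ ≠ ζ₂) :
    ∃ (c : ℂ) (t : ℝ), ‖c‖ = 1 ∧ t ^ 2 < 1 ∧ geodesic c t 1 = ζ₁ ∧ geodesic c t (-1) = ζ₂ := by
  have hz₂ : ζ₂ ≠ 0 := by rw [← norm_ne_zero_iff, h₂]; exact one_ne_zero
  -- The endpoint conditions amount to `((1 + t i) / (1 - t i))² = w`. Below, `X + i Y` is the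
  -- square root of `w` with positive real part, and `t` is the tangent of half its argument.
  set w : ℂ := -(ζ₁ / ζ₂) with hw
  have hwn : ‖w‖ = 1 := by rw [hw, norm_neg, norm_div, h₁, h₂, div_one]
  have hw0 : w ≠ 0 := by rw [← norm_ne_zero_iff, hwn]; exact one_ne_zero
  have hw1 : w ≠ -1 := by
    intro h
    apply hne
    have : ζ₁ / ζ₂ = 1 := by linear_combination -h
    rwa [div_eq_one_iff_eq hz₂] at this
  have hsq : w.re ^ 2 + w.im ^ 2 = 1 := by
    have := Complex.sq_norm w
    rw [hwn, Complex.normSq_apply] at this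
    linarith
  have hre : 0 < 1 + w.re := by
    have h1 : -1 ≤ w.re := by nlinarith [sq_nonneg w.im]
    rcases h1.lt_or_eq with h | h
    · linarith
    · exfalso
      apply hw1
      have him : w.im = 0 := by rw [← h] at hsq; nlinarith
      apply Complex.ext <;> simp [← h, him]
  set m : ℝ := √(2 * (1 + w.re)) with hm
  have hm2 : m ^ 2 = 2 * (1 + w.re) := Real.sq_sqrt (by linarith)
  have hm0 : 0 < m := Real.sqrt_pos.2 (by linarith)
  set X : ℝ := (1 + w.re) / m with hX
  set Y : ℝ := w.im / m with hY
  have hXpos : 0 < X := div_pos hre hm0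
  have hXY : X ^ 2 + Y ^ 2 = 1 := by
    rw [hX, hY, div_pow, div_pow, hm2]
    field_simp
    nlinarith
  set t : ℝ := Y / (1 + X) with ht
  have hX1 : (1 + X) ≠ 0 := by positivity
  have htX : (1 + X) * t = Y := by rw [ht]; field_simp
  have htY : (1 + X) * t ^ 2 = 1 - X := by
    have : (1 + X) * ((1 + X) * t ^ 2 - (1 - X)) = 0 := by
      have : (1 + X) * ((1 + X) * t ^ 2) = Y ^ 2 := by rw [← htX]; ring
      rw [mul_sub, this]; nlinarith
    have := (mul_eq_zero.1 this).resolve_left hX1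
    linarith
  have ht1 : t ^ 2 < 1 := by nlinarith
  have hD : (1 - t * Complex.I : ℂ) ≠ 0 := by simpa using geodesic_denom_ne_zero t 1
  have hD' : (1 + t * Complex.I : ℂ) ≠ 0 := by simpa using geodesic_denom_ne_zero t (-1)
  have hquot : (1 + t * Complex.I : ℂ) = (X + Y * Complex.I) * (1 - t * Complex.I) := by
    apply Complex.ext
    · simp; nlinarith
    · simp; nlinarith
  have hwsq : (X + Y * Complex.I : ℂ) ^ 2 = w := by
    have e1 : X ^ 2 - Y ^ 2 = w.re := by
      rw [hX, hY, div_pow, div_pow, hm2]; field_simp; nlinarith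
    have e2 : 2 * (X * Y) = w.im := by
      have : X * Y = (1 + w.re) * w.im / m ^ 2 := by rw [hX, hY]; field_simp
      rw [this, hm2]; field_simp
    apply Complex.ext
    · rw [pow_two]; simp; linarith
    · rw [pow_two]; simp; linarith
  have hcn : ‖(1 - t * Complex.I : ℂ)‖ = ‖(1 + t * Complex.I : ℂ)‖ := by
    have : (1 - t * Complex.I : ℂ) = conj (1 + t * Complex.I : ℂ) := by
      simp [sub_eq_add_neg]
    rw [this, Complex.norm_conj]
  refine ⟨ζ₁ * (1 - t * Complex.I) / (1 + t * Complex.I), t, ?_, ht1, ?_, ?_⟩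
  · rw [norm_div, norm_mul, h₁, one_mul, hcn, div_self (norm_ne_zero_iff.2 hD')]
  · rw [geodesic]
    push_cast
    field_simp
  · have hζ : ζ₁ = -w * ζ₂ := by rw [hw]; field_simp
    have h3 : (1 + t * Complex.I : ℂ) ^ 2 = w * (1 - t * Complex.I) ^ 2 := by
      rw [hquot, mul_pow, hwsq]
    rw [geodesic, div_mul_eq_mul_div, div_div, div_eq_iff]
    · push_cast
      rw [hζ]
      linear_combination -ζ₂ * h3
    · push_cast
      have : (1 - t * -1 * Complex.I : ℂ) = 1 + t * Complex.I := by ring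
      rw [this]
      exact mul_ne_zero hD' hD'

theorem exists_geodesic_through {z₁ z₂ : ℂ} (h₁ : ‖z₁‖ < 1) (h₂ : ‖z₂‖ < 1) (hne : z₁ ≠ z₂) :
    ∃ (c : ℂ) (t : ℝ), ‖c‖ = 1 ∧ t ^ 2 < 1 ∧ ∃ x ∈ Ioo (-1 : ℝ) 1, ∃ y ∈ Ioo (-1 : ℝ) 1,
      geodesic c t x = z₁ ∧ geodesic c t y = z₂ := by
  have hn₁ : Complex.normSq z₁ < 1 := by
    rw [Complex.normSq_eq_norm_sq]; nlinarith [norm_nonneg z₁]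
  have hn₂ : Complex.normSq z₂ < 1 := by
    rw [Complex.normSq_eq_norm_sq]; nlinarith [norm_nonneg z₂]
  have hdiff : Complex.normSq (1 - conj z₁ * z₂) - Complex.normSq (z₂ - z₁) =
      (1 - Complex.normSq z₁) * (1 - Complex.normSq z₂) := by
    simp [Complex.normSq_apply]; ring
  have hpos : 0 < (1 - Complex.normSq z₁) * (1 - Complex.normSq z₂) :=
    mul_pos (by linarith) (by linarith)
  have hden : (1 - conj z₁ * z₂) ≠ 0 := by
    rw [← Complex.normSq_pos]
    linarith [Complex.normSq_nonneg (z₂ - z₁)]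
  -- `w` is the image of `z₂` under an automorphism taking `z₁` to `0`. With `w = e r` and `z₁ = e
  -- b`, the geodesic `s ↦ e (s + b) / (1 + conj b s)` meets `z₁` at `s = 0` and `z₂` at `s = r`.
  set w : ℂ := (z₂ - z₁) / (1 - conj z₁ * z₂) with hw
  have hw0 : w ≠ 0 := div_ne_zero (sub_ne_zero.2 hne.symm) hden
  set r : ℝ := ‖w‖ with hr
  have hr0 : 0 < r := norm_pos_iff.2 hw0
  have hr1 : r < 1 := by
    have : r ^ 2 < 1 := by
      rw [hr, Complex.sq_norm, hw, map_div₀, div_lt_one (Complex.normSq_pos.2 hden)]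
      linarith
    nlinarith
  have hrc : (r : ℂ) ≠ 0 := by exact_mod_cast hr0.ne'
  set e : ℂ := w / r with he
  have hen : ‖e‖ = 1 := by
    rw [he, norm_div, Complex.norm_real, norm_norm]; exact div_self hr0.ne'
  have hwe : e * r = w := by rw [he]; field_simp
  have hee : e * conj e = 1 := by rw [Complex.mul_conj, Complex.normSq_eq_norm_sq, hen]; simp
  set b : ℂ := z₁ * conj e with hb
  have heb : e * b = z₁ := by rw [hb]; linear_combination z₁ * hee
  have hbn : Complex.normSq b < 1 := by
    rw [hb, map_mul, Complex.normSq_conj, Complex.normSq_eq_norm_sq e, hen]; linarith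
  -- Substituting `s = (x + t) / (1 + t x)` gives `e (A x + B) / (conj A + conj B x)`. This is of
  -- the form `geodesic` when `B / A` is purely imaginary, which is the quadratic equation for `t`;
  -- its left side changes sign on `(-1, 1)`.
  obtain ⟨t, ht, htq⟩ : ∃ t ∈ Ioo (-1 : ℝ) 1,
      b.re * t ^ 2 + (1 + Complex.normSq b) * t + b.re = 0 := by
    have hbr : b.re ^ 2 < 1 := by
      rw [Complex.normSq_apply] at hbn; nlinarith [mul_self_nonneg b.im]
    have hsq1 : 0 < 1 + Complex.normSq b - 2 * b.re := by
      rw [Complex.normSq_apply]; nlinarith [mul_self_nonneg b.im]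
    have hsq2 : 0 < 1 + Complex.normSq b + 2 * b.re := by
      rw [Complex.normSq_apply]; nlinarith [mul_self_nonneg b.im]
    have hc : ContinuousOn (fun t : ℝ => b.re * t ^ 2 + (1 + Complex.normSq b) * t + b.re)
        (Icc (-1) 1) := by fun_prop
    have := intermediate_value_Ioo (by norm_num : (-1 : ℝ) ≤ 1) hc
      (show (0 : ℝ) ∈ Ioo _ _ from ⟨by linarith, by linarith⟩)
    exact this
  have ht2 : t ^ 2 < 1 := by nlinarith [ht.1, ht.2]
  set A : ℂ := 1 + b * t with hA
  set B : ℂ := t + b with hB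
  have hAB : Complex.normSq A - Complex.normSq B = (1 - Complex.normSq b) * (1 - t ^ 2) := by
    rw [hA, hB]; simp [Complex.normSq_apply]; ring
  have hABpos : 0 < (1 - Complex.normSq b) * (1 - t ^ 2) := mul_pos (by linarith) (by linarith)
  have hA0 : A ≠ 0 := by
    rw [← Complex.normSq_pos]; linarith [Complex.normSq_nonneg B]
  have hcA0 : conj A ≠ 0 := by simpa using hA0
  set q : ℝ := (B / A).im with hq
  have hqBA : (B / A : ℂ) = q * Complex.I := by
    have hre : (B / A).re = 0 := by
      rw [Complex.div_re, ← add_div]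
      have : B.re * A.re + B.im * A.im = 0 := by
        rw [← htq, hA, hB, Complex.normSq_apply]; simp; ring
      rw [this, zero_div]
    apply Complex.ext <;> simp [hre, hq]
  have hBq : B = A * (q * Complex.I) := by rw [← hqBA]; field_simp
  have hcBq : conj B = conj A * (-(q * Complex.I)) := by rw [hBq]; simp
  have hq2 : q ^ 2 < 1 := by
    have h1 : Complex.normSq B = Complex.normSq A * q ^ 2 := by
      rw [hBq, map_mul]; simp [Complex.normSq_apply]; ring_nf; simp
    have h2 := Complex.normSq_pos.2 hA0
    nlinarith
  have hgeo : ∀ x : ℝ, geodesic (e * A / conj A) q x =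
      e * (A * x + B) / (conj A + conj B * x) := by
    intro x
    have h0 := geodesic_denom_ne_zero q x
    have h1 : conj A + conj B * x = conj A * (1 - q * x * Complex.I) := by rw [hcBq]; ring
    rw [h1, geodesic, hBq, div_mul_eq_mul_div, div_div]
    congr 1
    ring
  have htt : (1 - t ^ 2 : ℂ) ≠ 0 := by
    have : (1 - t ^ 2 : ℝ) ≠ 0 := by linarith
    exact_mod_cast this
  have hrt : 0 < 1 - r * t := by nlinarith [ht.1, ht.2]
  have hrtc : (1 - r * t : ℂ) ≠ 0 := by exact_mod_cast hrt.ne'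
  have hcA : conj A = 1 + conj b * t := by rw [hA]; simp
  have hcB : conj B = t + conj b := by rw [hB]; simp
  have hz₁ : 1 - z₁ * conj z₁ ≠ 0 := by
    rw [Complex.mul_conj]
    have : (1 - Complex.normSq z₁ : ℝ) ≠ 0 := by linarith
    exact_mod_cast this
  have hbr : conj b * r = conj z₁ * w := by
    rw [hb, map_mul, Complex.conj_conj, ← hwe]; ring
  have hwd : w * (1 - conj z₁ * z₂) = z₂ - z₁ := by rw [hw, div_mul_cancel₀ _ hden]
  have hmob : 1 + conj z₁ * w ≠ 0 := by
    have : (1 + conj z₁ * w) * (1 - conj z₁ * z₂) = 1 - z₁ * conj z₁ := by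
      linear_combination conj z₁ * hwd
    intro h
    rw [h, zero_mul] at this
    exact hz₁ this.symm
  refine ⟨e * A / conj A, q, ?_, hq2, -t, ⟨by linarith [ht.2], by linarith [ht.1]⟩,
    (r - t) / (1 - r * t), ⟨?_, ?_⟩, ?_, ?_⟩
  · rw [norm_div, norm_mul, hen, one_mul, Complex.norm_conj, div_self (norm_ne_zero_iff.2 hA0)]
  · rw [lt_div_iff₀ hrt]; nlinarith [mul_pos (by linarith : 0 < 1 + r) (by linarith [ht.2] : 0 < 1 - t)]
  · rw [div_lt_iff₀ hrt]; nlinarith [mul_pos (by linarith : 0 < 1 - r) (by linarith [ht.1] : 0 < 1 + t)]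
  · rw [hgeo, hcA, hcB, hA, hB]
    push_cast
    rw [div_eq_iff]
    · linear_combination (1 - (t : ℂ) ^ 2) * heb
    · intro h; apply htt; linear_combination h
  · have hnum : A * ((r - t) / (1 - r * t)) + B = (r + b) * (1 - t ^ 2) / (1 - r * t) := by
      rw [hA, hB, eq_div_iff hrtc, add_mul, mul_assoc, div_mul_cancel₀ _ hrtc]; ring
    have hdenom : conj A + conj B * ((r - t) / (1 - r * t)) =
        (1 + conj z₁ * w) * (1 - t ^ 2) / (1 - r * t) := by
      rw [← hbr, hcA, hcB, eq_div_iff hrtc, add_mul, mul_assoc, div_mul_cancel₀ _ hrtc]; ring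
    rw [hgeo]
    push_cast
    rw [hnum, hdenom, div_eq_iff (div_ne_zero (mul_ne_zero hmob htt) hrtc)]
    have h5 : e * (r + b) = z₂ * (1 + conj z₁ * w) := by
      linear_combination hwe + heb + hwd
    rw [← mul_div_assoc, ← mul_div_assoc, ← mul_assoc, ← mul_assoc, h5]

end Geodesics

/-! ### Holomorphic curves along geodesics. -/

section Main

variable {n : ℕ} {p : ℝ → ℝ} {φ : ℂ → EuclideanSpace ℂ (Fin n)}

theorem isRegularCurve_geodesic (hφ : DifferentiableOn ℂ φ (Metric.ball 0 1))
    (hφ' : ∀ z ∈ Metric.ball (0 : ℂ) 1, deriv φ z ≠ 0) {c : ℂ} (hc : ‖c‖ = 1) {t : ℝ}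
    (ht : t ^ 2 < 1) :
    IsRegularCurve (-1) 1 (fun x => φ (geodesic c t x))
      (fun x => geodesic₁ c t x • deriv φ (geodesic c t x))
      (fun x => geodesic₁ c t x ^ 2 • deriv (deriv φ) (geodesic c t x) +
        geodesic₂ c t x • deriv φ (geodesic c t x))
      (fun x => geodesic₁ c t x ^ 3 • deriv (deriv (deriv φ)) (geodesic c t x) +
        (3 * geodesic₁ c t x * geodesic₂ c t x) • deriv (deriv φ) (geodesic c t x) +
        geodesic₃ c t x • deriv φ (geodesic c t x)) := by
  have hφ₁ := hφ.deriv Metric.isOpen_ball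
  have hφ₂ := hφ₁.deriv Metric.isOpen_ball
  have hcomp : ∀ {g : ℂ → EuclideanSpace ℂ (Fin n)}, DifferentiableOn ℂ g (Metric.ball 0 1) →
      ∀ x ∈ Ioo (-1 : ℝ) 1, HasDerivAt (fun x => g (geodesic c t x))
        (geodesic₁ c t x • deriv g (geodesic c t x)) x := fun hg x hx =>
    (hasDerivAt_of_differentiableOn_ball hg (geodesic_mem_ball hc ht hx)).scomp x
      (hasDerivAt_geodesic c t x)
  refine ⟨hcomp hφ, fun x hx => ?_, fun x hx => ?_, fun x hx => ?_⟩
  · refine ((hasDerivAt_geodesic₁ c t x).smul (hcomp hφ₁ x hx)).congr_deriv ?_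
    rw [smul_smul, pow_two]
  · refine ((((hasDerivAt_geodesic₁ c t x).pow 2).smul (hcomp hφ₂ x hx)).add
      ((hasDerivAt_geodesic₂ c t x).smul (hcomp hφ₁ x hx))).congr_deriv ?_
    simp only [Pi.pow_apply, Nat.cast_ofNat]
    module
  · exact smul_ne_zero (geodesic₁_ne_zero hc ht x) (hφ' _ (geodesic_mem_ball hc ht hx))

theorem ahlforsSchwarzian_geodesic_le (hφ : DifferentiableOn ℂ φ (Metric.ball 0 1))
    (hφ' : ∀ z ∈ Metric.ball (0 : ℂ) 1, deriv φ z ≠ 0) {c : ℂ} (hc : ‖c‖ = 1) {t : ℝ}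
    (ht : t ^ 2 < 1) {x : ℝ} (hx : x ∈ Ioo (-1 : ℝ) 1) :
    ahlforsSchwarzian (geodesic₁ c t x • deriv φ (geodesic c t x))
      (geodesic₁ c t x ^ 2 • deriv (deriv φ) (geodesic c t x) +
        geodesic₂ c t x • deriv φ (geodesic c t x))
      (geodesic₁ c t x ^ 3 • deriv (deriv (deriv φ)) (geodesic c t x) +
        (3 * geodesic₁ c t x * geodesic₂ c t x) • deriv (deriv φ) (geodesic c t x) +
        geodesic₃ c t x • deriv φ (geodesic c t x)) ≤
      ‖geodesic₁ c t x‖ ^ 2 * criterionLHS φ (geodesic c t x) := by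
  have hz := geodesic_mem_ball hc ht hx
  rw [criterionLHS_eq hφ hφ' hz]
  exact ahlforsSchwarzian_reparam_le (hφ' _ hz) _ _ (geodesic₁_ne_zero hc ht x)
    (geodesic₃_eq hc ht x)

theorem IsNehari.criterion_geodesic_le (hp : IsNehari p)
    (hcrit : ∀ z ∈ Metric.ball (0 : ℂ) 1, criterionLHS φ z ≤ 2 * p ‖z‖) {c : ℂ} (hc : ‖c‖ = 1)
    {t : ℝ} (ht : t ^ 2 < 1) {x : ℝ} (hx : x ∈ Ioo (-1 : ℝ) 1) :
    ‖geodesic₁ c t x‖ ^ 2 * criterionLHS φ (geodesic c t x) ≤ 2 * p x := by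
  have h1 := hcrit _ (geodesic_mem_ball hc ht hx)
  have h2 := hp.geodesic_le hc ht hx
  have h3 := mul_le_mul_of_nonneg_left h1 (sq_nonneg ‖geodesic₁ c t x‖)
  linarith

/-- Injectivity in the disk under the curvature criterion. -/
theorem injOn_ball (hp : IsNehari p) (hφ : DifferentiableOn ℂ φ (Metric.ball 0 1))
    (hφ' : ∀ z ∈ Metric.ball (0 : ℂ) 1, deriv φ z ≠ 0)
    (hcrit : ∀ z ∈ Metric.ball (0 : ℂ) 1, criterionLHS φ z ≤ 2 * p ‖z‖) :
    InjOn φ (Metric.ball 0 1) := by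
  intro z₁ hz₁ z₂ hz₂ heq
  by_contra hne
  obtain ⟨u, v, hu0, hu, hv⟩ := hp.exists_pos_solution
  obtain ⟨c, t, hc, ht, x, hx, y, hy, rfl, rfl⟩ :=
    exists_geodesic_through (mem_ball_zero_iff.1 hz₁) (mem_ball_zero_iff.1 hz₂) hne
  have := (isRegularCurve_geodesic hφ hφ' hc ht).injOn ⟨hu0, hu, hv⟩
    (fun x hx => (ahlforsSchwarzian_geodesic_le hφ hφ' hc ht hx).trans
      (hp.criterion_geodesic_le hcrit hc ht hx)) hx hy heq
  exact hne (by rw [this])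

theorem tendsto_geodesic_left {c : ℂ} (hc : ‖c‖ = 1) {t : ℝ} (ht : t ^ 2 < 1) :
    Tendsto (geodesic c t) (𝓝[<] 1) (𝓝[Metric.ball (0 : ℂ) 1] (geodesic c t 1)) :=
  tendsto_nhdsWithin_iff.2
    ⟨(hasDerivAt_geodesic c t 1).continuousAt.tendsto.mono_left nhdsWithin_le_nhds,
      eventually_of_mem (Ioo_mem_nhdsLT (by norm_num)) fun _ hx => geodesic_mem_ball hc ht hx⟩

theorem tendsto_geodesic_right {c : ℂ} (hc : ‖c‖ = 1) {t : ℝ} (ht : t ^ 2 < 1) :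
    Tendsto (geodesic c t) (𝓝[>] (-1)) (𝓝[Metric.ball (0 : ℂ) 1] (geodesic c t (-1))) :=
  tendsto_nhdsWithin_iff.2
    ⟨(hasDerivAt_geodesic c t (-1)).continuousAt.tendsto.mono_left nhdsWithin_le_nhds,
      eventually_of_mem (Ioo_mem_nhdsGT (by norm_num)) fun _ hx => geodesic_mem_ball hc ht hx⟩

theorem HasBoundaryValue.tendsto_coe {ζ : ℂ} {P : EuclideanSpace ℂ (Fin n)}
    (h : HasBoundaryValue φ ζ P) : Tendsto φ (𝓝[Metric.ball (0 : ℂ) 1] ζ) (𝓝 P) :=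
  OnePoint.isOpenEmbedding_coe.tendsto_nhds_iff.2 h

theorem HasBoundaryValue.tendsto_norm {ζ : ℂ} (h : HasBoundaryValue φ ζ OnePoint.infty) :
    Tendsto (fun z => ‖φ z‖) (𝓝[Metric.ball (0 : ℂ) 1] ζ) atTop := by
  have h1 : Tendsto φ (𝓝[Metric.ball (0 : ℂ) 1] ζ) (cocompact _) := by
    rw [← coclosedCompact_eq_cocompact, ← OnePoint.comap_coe_nhds_infty, tendsto_comap_iff]
    exact h
  exact tendsto_norm_cocompact_atTop.comp h1

end Main

end HolCurve

end

theorem theorem3 (n : ℕ) (p : ℝ → ℝ) (hp : HolCurve.IsNehari p)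
    (φ : ℂ → EuclideanSpace ℂ (Fin n))
    (hφ : DifferentiableOn ℂ φ (Metric.ball 0 1))
    (hφ' : ∀ z ∈ Metric.ball (0 : ℂ) 1, deriv φ z ≠ 0)
    (hcrit : ∀ z ∈ Metric.ball (0 : ℂ) 1, HolCurve.criterionLHS φ z ≤ 2 * p ‖z‖)
    (P : OnePoint (EuclideanSpace ℂ (Fin n))) (hP : HolCurve.IsCutPoint φ P) :
    ∃ C : Set (OnePoint (EuclideanSpace ℂ (Fin n))),
      HolCurve.IsCircleOrLine C ∧ P ∈ C ∧
      C \ {P} ⊆ (fun z => (φ z : OnePoint (EuclideanSpace ℂ (Fin n)))) '' Metric.ball (0 : ℂ) 1 ∧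
      ∀ z ∈ Metric.ball (0 : ℂ) 1,
        (φ z : OnePoint (EuclideanSpace ℂ (Fin n))) ∈ C \ {P} →
          HolCurve.criterionLHS φ z = 2 * p ‖z‖ := by
  open HolCurve in
  obtain ⟨ζ₁, hζ₁, ζ₂, hζ₂, hne, h₁, h₂⟩ := hP
  obtain ⟨c, t, hc, ht, rfl, rfl⟩ := exists_geodesic_endpoints (mem_sphere_zero_iff_norm.1 hζ₁)
    (mem_sphere_zero_iff_norm.1 hζ₂) hne
  obtain ⟨u, v, hu0, hu, hv⟩ := hp.exists_pos_solution
  have hreg := isRegularCurve_geodesic hφ hφ' hc ht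
  have hle := fun x hx => ahlforsSchwarzian_geodesic_le hφ hφ' hc ht (x := x) hx
  have hle' := fun x hx => hp.criterion_geodesic_le hcrit hc ht (x := x) hx
  have hinj := injOn_ball hp hφ hφ' hcrit
  have hball := fun x hx => geodesic_mem_ball hc ht (x := x) hx
  -- It suffices that the geodesic maps onto `C \ {P}` and that the chain of bounds along it closes
  -- up at `2 p x`.
  suffices H : ∃ C : Set (OnePoint (EuclideanSpace ℂ (Fin n))), IsCircleOrLine C ∧ P ∈ C ∧
      C \ {P} = (fun x => (φ (geodesic c t x) : OnePoint (EuclideanSpace ℂ (Fin n)))) ''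
        Ioo (-1) 1 ∧
      ∀ x ∈ Ioo (-1 : ℝ) 1, 2 * p x ≤
        ‖geodesic₁ c t x‖ ^ 2 * criterionLHS φ (geodesic c t x) by
    obtain ⟨C, hC, hPC, hCP, hEq⟩ := H
    refine ⟨C, hC, hPC, ?_, fun z hz hzC => ?_⟩
    · rw [hCP]
      rintro _ ⟨x, hx, rfl⟩
      exact ⟨_, hball x hx, rfl⟩
    · rw [hCP] at hzC
      obtain ⟨x, hx, hxz⟩ := hzC
      -- Injectivity puts every point of the disk over `C \ {P}` on the geodesic. There `2 p x ≤
      -- |γ'|²` times the left side of (1), while `|γ'|² p(|γ|) ≤ p x`, and `|γ'|² > 0` cancels.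
      obtain rfl := hinj (hball x hx) hz (OnePoint.coe_injective hxz)
      have h1 := hEq x hx
      have h2 := hp.geodesic_le hc ht hx
      have h3 := hcrit _ hz
      have h4 : 0 < ‖geodesic₁ c t x‖ ^ 2 := by
        have := norm_pos_iff.2 (geodesic₁_ne_zero hc ht x); positivity
      refine le_antisymm h3 (le_of_mul_le_mul_left ?_ h4)
      linarith
  have hS := fun x hx => (hle x hx).trans (hle' x hx)
  induction P using OnePoint.rec with
  | infty =>
    obtain ⟨hEq, q, e, he, him⟩ := hreg.exists_line ⟨hu0, hu, hv⟩ hS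
      (h₂.tendsto_norm.comp (tendsto_geodesic_right hc ht))
      (h₁.tendsto_norm.comp (tendsto_geodesic_left hc ht))
    refine ⟨insert OnePoint.infty ((↑) '' {y | ∃ s : ℝ, y = q + s • e}),
      Or.inr ⟨_, ⟨q, e, he, rfl⟩, rfl⟩, Set.mem_insert _ _, ?_, fun x hx => ?_⟩
    · rw [← him, Set.image_image, Set.insert_sdiff_of_mem _ (Set.mem_singleton _),
        Set.sdiff_singleton_eq_self]
      rintro ⟨x, -, hx⟩
      exact OnePoint.coe_ne_infty _ hx
    · rw [← hEq x hx]
      exact hle x hx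
  | coe P =>
    obtain ⟨hEq, o, r, V, hr, hV, hPV, him⟩ := hreg.exists_circle ⟨hu0, hu, hv⟩ hS
      (h₂.tendsto_coe.comp (tendsto_geodesic_right hc ht))
      (h₁.tendsto_coe.comp (tendsto_geodesic_left hc ht))
    refine ⟨(↑) '' {x | x - o ∈ V ∧ ‖x - o‖ = r}, Or.inl ⟨_, ⟨o, r, V, hr, hV, rfl⟩, rfl⟩,
      ⟨P, hPV, rfl⟩, ?_, fun x hx => ?_⟩
    · rw [← Set.image_singleton, ← Set.image_sdiff OnePoint.coe_injective, ← him, Set.image_image]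
    · rw [← hEq x hx]
      exact hle x hx
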